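/- Let $H_1,H_2$ be separable real Hilbert spaces with a dense continuous inclusion $H_2\subset H_1$ (not necessarily compact), and write $|\cdot|_i$ for the norm of $H_i$; assume $|\cdot|_1\le|\cdot|_2$ on $H_2$. Let $O_1\subset\mathbb R\times H_1$ be open and $O_2:=O_1\cap(\mathbb R\times H_2)$. For a map $\phi$ on $O_1$ put $\phi_s(x):=\phi(s,x)$, defined on the slice $U_1^s:=\{x\in H_1\mid (s,x)\in O_1\}$. A $C^2$ map $\phi\colon O_1\to H_1$ is *parametrized tame* if (i) it restricts to a map $O_2\to H_2$ which is $C^2$ with respect to the topologies of $\mathbb R\times H_2$ and $H_2$, and (ii) every $(s,x)\in O_1$ has an open neighborhood $W\subset O_1$ (in $\mathbb R\times H_1$) and a constant $\kappa>0$ such that for all $(t,y)\in W\cap(\mathbb R\times H_2)$ and all $\xi,\eta\in H_2$ $$\bigl|d^2\phi_t|_y(\xi,\eta)\bigr|_2\le\kappa\bigl(|\xi|_1|\eta|_2+|\xi|_2|\eta|_1+|y|_2|\xi|_1|\eta|_1\bigr).$$ It is *asymptotically constant* if there is $T>0$ such that $\phi_s$, including its domain $U_1^s$, does not depend on $s$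 for $s\ge T$, does not depend on $s$ for $s\le -T$ (the two limits may differ), and $0\in U_1^s$, $\phi_s(0)=0$ for all $|s|\ge T$. Let $L^2_{H_i}:=L^2(\mathbb R,H_i)$, let $W^{1,2}_{H_1}:=W^{1,2}(\mathbb R,H_1)$ be the space of $\xi\in L^2_{H_1}$ with weak derivative $\dot\xi\in L^2_{H_1}$, and equip $W^{1,2}_{H_1}\cap L^2_{H_2}$ with the norm $\bigl(\|\xi\|_{L^2_{H_2}}^2+\|\dot\xi\|_{L^2_{H_1}}^2\bigr)^{1/2}$. Denote by $s\mapsto\xi_s\in H_1$ the continuous representative of $\xi\in W^{1,2}_{H_1}\cap L^2_{H_2}$. **Theorem.** Let $\phi\colon O_1\to H_1$ be asymptotically constant and parametrized tame, and let $$\mathcal U:=\{\xi\in W^{1,2}_{H_1}\cap L^2_{H_2}\mid (s,\xi_s)\in O_1\ \text{for all } s\in\mathbb R\}.$$ Then $\mathcal U$ is open in $W^{1,2}_{H_1}\cap L^2_{H_2}$. Moreover the map $$\Phi\colon\mathcal U\to W^{1,2}_{H_1}\cap L^2_{H_2},\qquad \Phi(\xi)(s):=\phi_s(\xi_s),$$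 and the weak tangent map $$T\Phi\colon\mathcal U\times L^2_{H_1}\to(W^{1,2}_{H_1}\cap L^2_{H_2})\times L^2_{H_1},\qquad (\xi,\eta)\mapsto\bigl(\Phi(\xi),\,[s\mapsto d\phi_s|_{\xi_s}\eta_s]\bigr),$$ are well defined and continuously differentiable. -/

import Mathlib

open MeasureTheory Set
open scoped ContDiff

/-- `L²(ℝ, H)`, with Lebesgue measure on `ℝ`. -/
abbrev L2R (H : Type*) [NormedAddCommGroup H] : Type _ :=
  Lp H 2 (volume : Measure ℝ)

/-- `v` is the weak derivative of `f`: for every test function `θ ∈ C_c^∞(ℝ, H)`,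
`∫ ⟨f, θ'⟩ = - ∫ ⟨v, θ⟩`. Thus `f ∈ W^{1,2}(ℝ, H)` iff some `v ∈ L²(ℝ, H)` has this property. -/
def HasWeakDeriv {H : Type*} [NormedAddCommGroup H] [InnerProductSpace ℝ H]
    (f v : L2R H) : Prop :=
  ∀ θ : ℝ → H, ContDiff ℝ ∞ θ → HasCompactSupport θ →
    ∫ t, inner ℝ (f t) (deriv θ t) = - ∫ t, inner ℝ (v t) (θ t)

section Helpers

variable {H : Type*} [NormedAddCommGroup H] [InnerProductSpace ℝ H]

theorem integrable_inner_test (f : L2R H) {θ : ℝ → H} (hθ : Continuous θ)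
    (hc : HasCompactSupport θ) : Integrable (fun t => inner ℝ (f t) (θ t)) := by
  have h2 : MemLp θ 2 (volume : Measure ℝ) := hθ.memLp_of_hasCompactSupport hc
  have := L2.integrable_inner (𝕜 := ℝ) f h2.toLp
  refine this.congr ?_
  filter_upwards [h2.coeFn_toLp] with t ht
  rw [ht]

theorem integrable_inner_deriv_test (f : L2R H) {θ : ℝ → H} (hθ : ContDiff ℝ ∞ θ)
    (hc : HasCompactSupport θ) : Integrable (fun t => inner ℝ (f t) (deriv θ t)) :=
  integrable_inner_test f (hθ.continuous_deriv (by simp)) hc.deriv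

theorem HasWeakDeriv.add {f g v w : L2R H} (hf : HasWeakDeriv f v) (hg : HasWeakDeriv g w) :
    HasWeakDeriv (f + g) (v + w) := by
  intro θ hθ hc
  have e1 : (fun t => inner ℝ ((f + g : L2R H) t) (deriv θ t)) =ᵐ[volume]
      fun t => inner ℝ (f t) (deriv θ t) + inner ℝ (g t) (deriv θ t) := by
    filter_upwards [Lp.coeFn_add f g] with t ht
    rw [ht, Pi.add_apply, inner_add_left]
  have e2 : (fun t => inner ℝ ((v + w : L2R H) t) (θ t)) =ᵐ[volume]
      fun t => inner ℝ (v t) (θ t) + inner ℝ (w t) (θ t) := by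
    filter_upwards [Lp.coeFn_add v w] with t ht
    rw [ht, Pi.add_apply, inner_add_left]
  rw [integral_congr_ae e1, integral_congr_ae e2,
    integral_add (integrable_inner_deriv_test f hθ hc) (integrable_inner_deriv_test g hθ hc),
    integral_add (integrable_inner_test v hθ.continuous hc)
      (integrable_inner_test w hθ.continuous hc), hf θ hθ hc, hg θ hθ hc]
  ring

theorem HasWeakDeriv.smul {f v : L2R H} (c : ℝ) (hf : HasWeakDeriv f v) :
    HasWeakDeriv (c • f) (c • v) := by
  intro θ hθ hc
  have e1 : (fun t => inner ℝ ((c • f : L2R H) t) (deriv θ t)) =ᵐ[volume]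
      fun t => c * inner ℝ (f t) (deriv θ t) := by
    filter_upwards [Lp.coeFn_smul c f] with t ht
    rw [ht, Pi.smul_apply, real_inner_smul_left]
  have e2 : (fun t => inner ℝ ((c • v : L2R H) t) (θ t)) =ᵐ[volume]
      fun t => c * inner ℝ (v t) (θ t) := by
    filter_upwards [Lp.coeFn_smul c v] with t ht
    rw [ht, Pi.smul_apply, real_inner_smul_left]
  rw [integral_congr_ae e1, integral_congr_ae e2, integral_const_mul, integral_const_mul,
    hf θ hθ hc]
  ring

theorem HasWeakDeriv.zero : HasWeakDeriv (0 : L2R H) 0 := by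
  intro θ hθ hc
  have e (w : ℝ → H) : (fun t => inner ℝ ((0 : L2R H) t) (w t)) =ᵐ[volume] fun _ => (0 : ℝ) := by
    filter_upwards [Lp.coeFn_zero H 2 (volume : Measure ℝ)] with t ht
    rw [ht, Pi.zero_apply, inner_zero_left]
  rw [integral_congr_ae (e _), integral_congr_ae (e _), integral_zero, neg_zero]

/-- The weak derivative is unique. -/
theorem HasWeakDeriv.unique [CompleteSpace H] {f v w : L2R H} (hv : HasWeakDeriv f v)
    (hw : HasWeakDeriv f w) : v = w := by
  have h0 : HasWeakDeriv (0 : L2R H) (v - w) := by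
    have := hv.add (hw.smul (-1))
    simpa [sub_eq_add_neg] using this
  have hloc : LocallyIntegrable (fun t => (v - w : L2R H) t) (volume : Measure ℝ) :=
    (Lp.memLp (v - w)).locallyIntegrable (by norm_num)
  have key : ∀ᵐ t ∂(volume : Measure ℝ), (v - w : L2R H) t = 0 := by
    refine ae_eq_zero_of_integral_contDiff_smul_eq_zero hloc fun g hg hgc => ?_
    have hint : Integrable (fun t => g t • (v - w : L2R H) t) :=
      hloc.integrable_smul_left_of_hasCompactSupport hg.continuous hgc
    refine ext_inner_left ℝ fun c => ?_
    rw [inner_zero_right, ← integral_inner hint c]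
    have h1 := h0 (fun t => g t • c) (hg.smul contDiff_const) hgc.smul_right
    have e1 : (fun t => inner ℝ ((0 : L2R H) t) (deriv (fun t => g t • c) t)) =ᵐ[volume]
        fun _ => (0 : ℝ) := by
      filter_upwards [Lp.coeFn_zero H 2 (volume : Measure ℝ)] with t ht
      rw [ht]; simp
    rw [integral_congr_ae e1, integral_zero] at h1
    have h2 : ∫ t, inner ℝ ((v - w : L2R H) t) (g t • c) = 0 := by linarith
    rw [← h2]
    refine integral_congr_ae (Filter.Eventually.of_forall fun t => ?_)
    simp only [inner_smul_right, real_inner_comm]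
  have : v - w = 0 := by
    apply Lp.ext
    filter_upwards [key, Lp.coeFn_zero H 2 (volume : Measure ℝ)] with t ht h0t
    rw [ht, h0t]; rfl
  exact sub_eq_zero.mp this

end Helpers

section Spaces

variable {H₁ H₂ : Type*} [NormedAddCommGroup H₁] [InnerProductSpace ℝ H₁]
  [NormedAddCommGroup H₂] [InnerProductSpace ℝ H₂]

/-- The inner product space `W^{1,2}(ℝ, H₁) ∩ L²(ℝ, H₂)`, where `ι : H₂ → H₁` is the inclusion.
Its elements are the `ξ ∈ L²(ℝ, H₂)` such that `ι ∘ ξ ∈ L²(ℝ, H₁)` has a weak derivative `ξ'`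
in `L²(ℝ, H₁)`; the element is stored together with its (unique) weak derivative, as the pair
`(ξ, ξ')`. The inherited inner product is `∫ ⟨ξ, η⟩_{H₂} + ∫ ⟨ξ', η'⟩_{H₁}`. -/
noncomputable def pathSpace (ι : H₂ →L[ℝ] H₁) :
    Submodule ℝ (WithLp 2 (L2R H₂ × L2R H₁)) where
  carrier := {p | HasWeakDeriv (ι.compLpL 2 volume p.fst) p.snd}
  add_mem' := by
    intro p q hp hq
    have h := HasWeakDeriv.add hp hq
    rw [← map_add] at h
    exact h
  zero_mem' := by
    have h : HasWeakDeriv (0 : L2R H₁) 0 := HasWeakDeriv.zero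
    change HasWeakDeriv (ι.compLpL 2 (volume : Measure ℝ) 0) 0
    rwa [map_zero]
  smul_mem' := by
    intro c p hp
    have h := HasWeakDeriv.smul c hp
    rw [← map_smul] at h
    exact h

/-- `u : ℝ → H₁` is the continuous representative of `ξ ∈ W^{1,2}(ℝ, H₁) ∩ L²(ℝ, H₂)`; its
value `u s` is what is denoted `ξ_s`. -/
def IsContRep (ι : H₂ →L[ℝ] H₁) (ξ : pathSpace ι) (u : ℝ → H₁) : Prop :=
  Continuous u ∧ u =ᵐ[volume] fun s => ι (ξ.1.fst s)

/-- The set `𝒰` of all `ξ ∈ W^{1,2}(ℝ, H₁) ∩ L²(ℝ, H₂)` with `(s, ξ_s) ∈ O₁` for all `s`. -/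
def pathDomain (ι : H₂ →L[ℝ] H₁) (O₁ : Set (ℝ × H₁)) : Set (pathSpace ι) :=
  {ξ | ∃ u : ℝ → H₁, IsContRep ι ξ u ∧ ∀ s, (s, u s) ∈ O₁}

/-- A map `φ : O₁ → H₁` on an open subset `O₁` of `ℝ × H₁` (given by a function on `ℝ × H₁` whose
values off `O₁` play no role) is parametrized tame. Here `φ₂` is the restriction of `φ` to
`O₂ = O₁ ∩ (ℝ × H₂)`, as a map with values in `H₂`. -/
structure IsParametrizedTame (ι : H₂ →L[ℝ] H₁) (O₁ : Set (ℝ × H₁)) (φ : ℝ × H₁ → H₁) :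
    Prop where
  isOpen : IsOpen O₁
  contDiffOn : ContDiffOn ℝ 2 φ O₁
  exists_restriction : ∃ φ₂ : ℝ × H₂ → H₂,
    (∀ t y, (t, ι y) ∈ O₁ → ι (φ₂ (t, y)) = φ (t, ι y)) ∧
    ContDiffOn ℝ 2 φ₂ {p | (p.1, ι p.2) ∈ O₁} ∧
    ∀ p ∈ O₁, ∃ W : Set (ℝ × H₁), IsOpen W ∧ p ∈ W ∧ W ⊆ O₁ ∧ ∃ κ : ℝ, 0 < κ ∧
      ∀ t y, (t, ι y) ∈ W → ∀ ξ η : H₂,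
        ‖fderiv ℝ (fderiv ℝ fun z => φ₂ (t, z)) y ξ η‖ ≤
          κ * (‖ι ξ‖ * ‖η‖ + ‖ξ‖ * ‖ι η‖ + ‖y‖ * ‖ι ξ‖ * ‖ι η‖)

end Spaces

/-- `φ : O₁ → H₁` is asymptotically constant: for some `T > 0`, the slice `φ_s : U₁^s → H₁`
(including its domain) does not depend on `s` on either of the two ends `s ≤ -T` and `s ≥ T`,
and `φ_s(0) = 0` (in particular `0 ∈ U₁^s`) whenever `|s| ≥ T`. -/
def IsAsymptoticallyConstant {H : Type*} [NormedAddCommGroup H]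
    (O₁ : Set (ℝ × H)) (φ : ℝ × H → H) : Prop :=
  ∃ T : ℝ, 0 < T ∧
    (∀ s t : ℝ, (s ≤ -T ∧ t ≤ -T) ∨ (T ≤ s ∧ T ≤ t) →
      ∀ x, ((s, x) ∈ O₁ ↔ (t, x) ∈ O₁) ∧ ((s, x) ∈ O₁ → φ (s, x) = φ (t, x))) ∧
    ∀ s : ℝ, T ≤ |s| → (s, 0) ∈ O₁ ∧ φ (s, 0) = 0

/-! An element of the path space is a pair (ξ, ξ') in L²(H₂) × L²(H₁), so Φ is C¹ once both
components are and the resulting pair lies in the closed subspace cut out by the weak derivative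
condition. The Sobolev embedding into C₀(ℝ, H₁) controls ξ in the sup norm of H₁. Since φ is
constant in s on both ends, time may be clamped to [-T, T]; the clamped graph of ξ lies in a compact
subset of O₁. This gives openness of 𝒰 and makes all local estimates uniform in s.

The derivative component is ∂_sφ(s, ξ_s) + dφ_s|_{ξ_s} ξ'_s. Superposition with a C¹ map is C¹ from
C₀ into bounded continuous functions (`contDiffOn_nemytskii`). As φ is C², this applies to ∂_sφ and
dφ_s, and bounded operator-valued functions act on L² by multiplication (`mulL2`). The same argument
handles the weak tangent map; tameness plays no role here. The chain rule for absolutely continuous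
curves identifies the formula with the weak derivative.

Tameness is needed for the L²(H₂) component, because |ξ_s|_2 is only square integrable and not
bounded. Each term of the tame estimate for d²φ contains exactly one H₂ norm; the other factors are
H₁ norms, which are uniformly bounded. Integrating d²φ along segments therefore bounds the Taylor
remainder by sup norms times L² norms, that is, quadratically in the increment
(`contDiffOn_superposition`). That Φ(ξ) is in L²(H₂) at all follows from the linear growth implied
by tameness, together with φ_s(0) = 0 on the ends. -/

open Filter Topology
open scoped BoundedContinuousFunction ZeroAtInfty

/-! ### Chain rule along absolutely continuous curves -/

section ChainRule

variable {E F : Type*} [NormedAddCommGroup E] [NormedSpace ℝ E]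
  [NormedAddCommGroup F] [NormedSpace ℝ F]

theorem norm_one_prod_le {E : Type*} [NormedAddCommGroup E] (x : E) : ‖((1 : ℝ), x)‖ ≤ 1 + ‖x‖ := by
  rw [Prod.norm_def]
  exact max_le (by simp) (by simp)

theorem intervalIntegrable_clm_apply_one {L : ℝ → (ℝ × E →L[ℝ] F)} (hL : Continuous L)
    {v : ℝ → E} (hv : LocallyIntegrable v) (a b : ℝ) :
    IntervalIntegrable (fun t => L t (1, v t)) volume a b := by
  have hvi : IntervalIntegrable v volume a b := (hv.integrableOn_isCompact isCompact_uIcc).intervalIntegrable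
  obtain ⟨C, hC⟩ := isCompact_uIcc.exists_bound_of_continuousOn (s := uIcc a b) hL.continuousOn
  have hg : IntervalIntegrable (fun t => C * (1 + ‖v t‖)) volume a b :=
    (intervalIntegrable_const.add hvi.norm).const_mul C
  refine hg.mono_fun ?_ ?_
  · have h1 : AEStronglyMeasurable (fun t => ((1 : ℝ), v t)) volume :=
      aestronglyMeasurable_const.prodMk hv.aestronglyMeasurable
    exact ((ContinuousLinearMap.id ℝ (ℝ × E →L[ℝ] F)).aestronglyMeasurable_comp₂
      hL.aestronglyMeasurable h1).restrict
  · refine (ae_restrict_mem measurableSet_uIoc).mono fun t ht => ?_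
    have hCt := hC t (uIoc_subset_uIcc ht)
    have hC0 : 0 ≤ C := (norm_nonneg _).trans hCt
    beta_reduce
    rw [Real.norm_of_nonneg (by positivity)]
    refine ((L t).le_opNorm _).trans ?_
    gcongr
    exact norm_one_prod_le _

/-- The chain rule for absolutely continuous curves, in integrated form. -/
theorem sub_eq_integral_of_hasFDerivAt [CompleteSpace E] [CompleteSpace F] {u v : ℝ → E}
    (hv : LocallyIntegrable v)
    (hu : ∀ a b, u b - u a = ∫ t in a..b, v t) {φ : ℝ × E → F} {φ' : ℝ × E → (ℝ × E →L[ℝ] F)}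
    (hφ : ∀ t, HasFDerivAt φ (φ' (t, u t)) (t, u t)) (hφ' : Continuous fun t => φ' (t, u t))
    {a b : ℝ} (hab : a ≤ b) :
    φ (b, u b) - φ (a, u a) = ∫ t in a..b, φ' (t, u t) (1, v t) := by
  have hvi : ∀ a b, IntervalIntegrable v volume a b := fun a b => (hv.integrableOn_isCompact isCompact_uIcc).intervalIntegrable
  have hDi : ∀ a b, IntervalIntegrable (fun t => φ' (t, u t) (1, v t)) volume a b :=
    intervalIntegrable_clm_apply_one hφ' hv
  have hmi : ∀ a b, IntervalIntegrable (fun t => 1 + ‖v t‖) volume a b := fun a b =>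
    intervalIntegrable_const.add (hvi a b).norm
  have hucont : Continuous u := by
    have : u = fun t => u a + ∫ r in a..t, v r := by
      ext t; rw [← hu a t]; abel
    rw [this]
    exact continuous_const.add (intervalIntegral.continuous_primitive hvi a)
  have hφu : Continuous fun t => φ (t, u t) := continuous_iff_continuousAt.2 fun t =>
    ContinuousAt.comp (g := φ) (f := fun t => (t, u t)) (hφ t).continuousAt
      (continuous_id.prodMk hucont).continuousAt
  set G : ℝ → F := fun t => φ (t, u t) - φ (a, u a) - ∫ r in a..t, φ' (r, u r) (1, v r) with hG
  -- The increments of `m` dominate those of both t and `u`, hence the displacement of the graph in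
  -- the sup norm. An error of relative size ε is thus at most ε times the increment of `m`.
  set m : ℝ → ℝ := fun t => ∫ r in a..t, (1 + ‖v r‖) with hm
  have hGc : Continuous G :=
    (hφu.sub continuous_const).sub (intervalIntegral.continuous_primitive hDi a)
  have hmc : Continuous m := intervalIntegral.continuous_primitive hmi a
  have key : ∀ ε > 0, ‖G b‖ ≤ ε * m b := by
    intro ε hε
    have hsub : Icc a b ⊆ {t | ‖G t‖ ≤ ε * m t} := by
      -- Continuous induction on [a, b]: the set is closed and contains a, and the bound propagates
      -- a little to the right of each of its points. Differentiability of φ at the points of the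
      -- graph is all this uses, so no convexity of a domain is required.
      refine IsClosed.Icc_subset_of_forall_exists_gt ?_ ?_ ?_
      · exact (isClosed_le hGc.norm (continuous_const.mul hmc)).inter isClosed_Icc
      · simp [hG, hm]
      · rintro x ⟨hx, hxab⟩ y (hy : x < y)
        have hlin : ∀ᶠ t in 𝓝 x, ‖φ (t, u t) - φ (x, u x) - φ' (x, u x) ((t, u t) - (x, u x))‖
            ≤ ε / 2 * ‖(t, u t) - (x, u x)‖ :=
          (continuous_id.prodMk hucont).continuousAt.eventually
            ((hφ x).isLittleO.def (half_pos hε))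
        have hcts : ∀ᶠ t in 𝓝 x, ‖φ' (t, u t) - φ' (x, u x)‖ ≤ ε / 2 := by
          have := Metric.tendsto_nhds.1 (hφ'.continuousAt (x := x)) (ε / 2) (half_pos hε)
          filter_upwards [this] with t ht
          rw [← dist_eq_norm]; exact ht.le
        obtain ⟨δ, hδ, hδ'⟩ := Metric.eventually_nhds_iff.1 (hlin.and hcts)
        set t := min y (x + δ / 2) with ht
        have hxt : x < t := lt_min hy (by linarith)
        have htx : t ≤ x + δ / 2 := min_le_right _ _
        refine ⟨t, ?_, hxt, min_le_left _ _⟩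
        have hnear : ∀ r ∈ Icc x t, dist r x < δ := fun r hr => by
          rw [Real.dist_eq, abs_of_nonneg (by linarith [hr.1])]; linarith [hr.2]
        have hmt : m t - m x = ∫ r in x..t, (1 + ‖v r‖) :=
          intervalIntegral.integral_interval_sub_left (hmi _ _) (hmi _ _)
        have hGt : G t - G x = φ (t, u t) - φ (x, u x) - ∫ r in x..t, φ' (r, u r) (1, v r) := by
          rw [← intervalIntegral.integral_interval_sub_left (hDi a t) (hDi a x)]
          simp only [hG]; abel
        have hnorm : ‖(t, u t) - (x, u x)‖ ≤ m t - m x := by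
          rw [hmt, Prod.norm_def]
          refine max_le ?_ ?_
          · simp only [Prod.fst_sub, Real.norm_eq_abs, abs_of_pos (sub_pos.2 hxt)]
            have : t - x = ∫ _ in x..t, (1 : ℝ) := by simp
            rw [this]
            exact intervalIntegral.integral_mono_on hxt.le intervalIntegrable_const (hmi _ _)
              fun r _ => by linarith [norm_nonneg (v r)]
          · simp only [Prod.snd_sub]
            rw [hu x t]
            refine (intervalIntegral.norm_integral_le_integral_norm hxt.le).trans ?_
            exact intervalIntegral.integral_mono_on hxt.le (hvi _ _).norm (hmi _ _)
              fun r _ => by linarith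
        -- With the derivative frozen at x, the first-order term is exactly the integral of the
        -- frozen derivative, since `u` is the primitive of `v`.
        have hconst : φ' (x, u x) ((t, u t) - (x, u x))
            = ∫ r in x..t, φ' (x, u x) (1, v r) := by
          set L := φ' (x, u x)
          have e : ∀ y : E, L (1, y) = L (1, 0) + (L.comp (.inr ℝ ℝ E)) y := fun y => by
            simp [← map_add]
          simp_rw [fun r => e (v r)]
          rw [intervalIntegral.integral_add intervalIntegrable_const
            ((intervalIntegrable_iff_integrableOn_Ioc_of_le hxt.le).2
              ((L.comp (.inr ℝ ℝ E)).integrable_comp (hvi x t).1)),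
            (L.comp (.inr ℝ ℝ E)).intervalIntegral_comp_comm (hvi _ _), ← hu x t]
          have : (t, u t) - (x, u x) = (t - x) • ((1 : ℝ), (0 : E)) + (0, u t - u x) := by simp
          rw [this, map_add, map_smul, intervalIntegral.integral_const]
          rfl
        have hint : ‖(∫ r in x..t, φ' (r, u r) (1, v r)) - ∫ r in x..t, φ' (x, u x) (1, v r)‖
            ≤ ε / 2 * (m t - m x) := by
          rw [← intervalIntegral.integral_sub (hDi _ _)
            (intervalIntegrable_clm_apply_one continuous_const hv _ _), hmt,
            ← intervalIntegral.integral_const_mul]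
          refine intervalIntegral.norm_integral_le_of_norm_le hxt.le ?_ ((hmi _ _).const_mul _)
          refine Eventually.of_forall fun r hr => ?_
          rw [← sub_apply]
          refine (ContinuousLinearMap.le_opNorm _ _).trans ?_
          have := (hδ' (hnear r ⟨hr.1.le, hr.2⟩)).2
          gcongr
          exact norm_one_prod_le _
        have h1 := (hδ' (hnear t ⟨hxt.le, le_rfl⟩)).1
        have hGd : ‖G t - G x‖ ≤ ε * (m t - m x) := by
          rw [hGt]
          have : φ (t, u t) - φ (x, u x) - ∫ r in x..t, φ' (r, u r) (1, v r)
              = (φ (t, u t) - φ (x, u x) - φ' (x, u x) ((t, u t) - (x, u x)))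
                - ((∫ r in x..t, φ' (r, u r) (1, v r)) - ∫ r in x..t, φ' (x, u x) (1, v r)) := by
            rw [hconst]; abel
          rw [this]
          refine (norm_sub_le _ _).trans ?_
          have h2 := h1.trans (mul_le_mul_of_nonneg_left hnorm (half_pos hε).le)
          linarith
        have hx' : ‖G x‖ ≤ ε * m x := hx
        have : ‖G t‖ ≤ ‖G t - G x‖ + ‖G x‖ := by simpa using norm_add_le (G t - G x) (G x)
        change ‖G t‖ ≤ ε * m t
        linarith
    exact hsub ⟨hab, le_rfl⟩
  have hlim : Tendsto (fun ε : ℝ => ε * m b) (𝓝[>] 0) (𝓝 0) := by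
    have : Tendsto (fun ε : ℝ => ε * m b) (𝓝 0) (𝓝 (0 * m b)) :=
      tendsto_id.mul tendsto_const_nhds
    rw [zero_mul] at this
    exact this.mono_left nhdsWithin_le_nhds
  have h0 : ‖G b‖ ≤ 0 := ge_of_tendsto hlim (eventually_nhdsWithin_of_forall key)
  exact sub_eq_zero.1 (norm_le_zero_iff.1 h0)

end ChainRule

/-! ### Weak derivatives, absolutely continuous representatives and the Sobolev embedding -/

section WeakDerivative

variable {H : Type*} [NormedAddCommGroup H] [InnerProductSpace ℝ H] [CompleteSpace H]

/-- A primitive of a locally integrable function is continuous. -/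
theorem continuous_of_sub_eq_integral {E : Type*} [NormedAddCommGroup E] [NormedSpace ℝ E]
    {u v : ℝ → E} (hv : LocallyIntegrable v) (hu : ∀ a b, u b - u a = ∫ t in a..b, v t) :
    Continuous u := by
  have : u = fun t => u 0 + ∫ r in (0 : ℝ)..t, v r := by
    ext t; rw [← hu 0 t]; abel
  rw [this]
  exact continuous_const.add (intervalIntegral.continuous_primitive
    (fun a b => (hv.integrableOn_isCompact isCompact_uIcc).intervalIntegrable) 0)

/-- The chain rule applied to (t, x) ↦ ⟨x, θ(t)⟩. -/
theorem inner_sub_eq_integral {u v θ : ℝ → H} (hv : LocallyIntegrable v)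
    (hu : ∀ a b, u b - u a = ∫ t in a..b, v t) (hθ : ContDiff ℝ 1 θ) {a b : ℝ} (hab : a ≤ b) :
    inner ℝ (u b) (θ b) - inner ℝ (u a) (θ a)
      = ∫ t in a..b, (inner ℝ (u t) (deriv θ t) + inner ℝ (v t) (θ t)) := by
  have hθd : ∀ t, HasDerivAt θ (deriv θ t) t := fun t =>
    (hθ.differentiable one_ne_zero t).hasDerivAt
  have hθc : Continuous (deriv θ) := hθ.continuous_deriv le_rfl
  have huc := continuous_of_sub_eq_integral hv hu
  have h := sub_eq_integral_of_hasFDerivAt hv hu (φ := fun p => inner ℝ p.2 (θ p.1))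
    (φ' := fun p => (fderivInnerCLM ℝ (p.2, θ p.1)).comp ((ContinuousLinearMap.snd ℝ ℝ H).prod
      ((ContinuousLinearMap.toSpanSingleton ℝ (deriv θ p.1)).comp (.fst ℝ ℝ H))))
    (fun t => by
      refine HasFDerivAt.inner ℝ hasFDerivAt_snd ?_
      exact (hθd t).hasFDerivAt.comp (t, u t) hasFDerivAt_fst)
    (by
      have h1 : Continuous fun p : H × H => fderivInnerCLM ℝ p := by
        have := (isBoundedBilinearMap_inner (𝕜 := ℝ) (E := H)).isBoundedLinearMap_deriv.continuous
        exact this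
      have h2 : Continuous fun t => ContinuousLinearMap.toSpanSingleton ℝ (deriv θ t) :=
        (ContinuousLinearMap.toSpanSingletonCLE (𝕜 := ℝ) (E := H)).continuous.comp hθc
      refine (h1.comp (huc.prodMk hθ.continuous)).clm_comp ?_
      exact (ContinuousLinearMap.prodₗᵢ (𝕜 := ℝ) (E := ℝ × H) (F := H) (G := H) ℝ).continuous.comp
        (continuous_const.prodMk (h2.clm_comp continuous_const))) hab
  rw [h]
  refine intervalIntegral.integral_congr fun t _ => ?_
  simp [fderivInnerCLM_apply]

theorem exists_tsupport_subset_Ioo {E : Type*} [Zero E] {θ : ℝ → E} (hc : HasCompactSupport θ) :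
    ∃ R > 0, tsupport θ ⊆ Ioo (-R) R := by
  obtain ⟨R, hR, h⟩ := hc.isCompact.isBounded.subset_ball_lt 0 0
  exact ⟨R, hR, by simpa [Real.ball_eq_Ioo] using h⟩

theorem integral_inner_deriv_eq_neg {u v θ : ℝ → H} (hv : LocallyIntegrable v)
    (hu : ∀ a b, u b - u a = ∫ t in a..b, v t) (hθ : ContDiff ℝ 1 θ)
    (hc : HasCompactSupport θ) :
    ∫ t, inner ℝ (u t) (deriv θ t) = - ∫ t, inner ℝ (v t) (θ t) := by
  obtain ⟨R, hR, hsub⟩ := exists_tsupport_subset_Ioo hc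
  have huc := continuous_of_sub_eq_integral hv hu
  have hsub' : tsupport (deriv θ) ⊆ Ioo (-R) R :=
    tsupport_deriv_subset.trans hsub
  have h := inner_sub_eq_integral hv hu hθ (show -R ≤ R by linarith)
  have hz : ∀ x, x ∉ Ioo (-R) R → θ x = 0 := fun x hx =>
    image_eq_zero_of_notMem_tsupport fun h' => hx (hsub h')
  have hz' : ∀ x, x ∉ Ioo (-R) R → deriv θ x = 0 := fun x hx =>
    image_eq_zero_of_notMem_tsupport fun h' => hx (hsub' h')
  rw [hz R (by simp), hz (-R) (by simp)] at h
  have hi1 : IntervalIntegrable (fun t => inner ℝ (u t) (deriv θ t)) volume (-R) R :=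
    (huc.inner (hθ.continuous_deriv le_rfl)).intervalIntegrable _ _
  have hi2 : IntervalIntegrable (fun t => inner ℝ (v t) (θ t)) volume (-R) R := by
    refine (IntegrableOn.intervalIntegrable ?_)
    obtain ⟨C, hC⟩ := isCompact_uIcc.exists_bound_of_continuousOn (s := uIcc (-R) R)
      hθ.continuous.continuousOn
    refine ((hv.integrableOn_isCompact isCompact_uIcc).norm.mul_const C).mono'
      (hv.aestronglyMeasurable.inner hθ.continuous.aestronglyMeasurable).restrict ?_
    refine (ae_restrict_mem measurableSet_uIcc).mono fun t ht => ?_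
    exact (norm_inner_le_norm _ _).trans (by gcongr; exact hC t ht)
  rw [intervalIntegral.integral_add hi1 hi2,
    intervalIntegral.integral_eq_integral_of_support_subset,
    intervalIntegral.integral_eq_integral_of_support_subset] at h
  · simp only [inner_zero_right, sub_zero] at h
    linarith
  · intro x hx
    by_contra hx'
    exact hx (by simp [hz x (fun h => hx' (Ioo_subset_Ioc_self h))])
  · intro x hx
    by_contra hx'
    exact hx (by simp [hz' x (fun h => hx' (Ioo_subset_Ioc_self h))])

theorem Lp_two_locallyIntegrable {E : Type*} [NormedAddCommGroup E] (f : L2R E) :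
    LocallyIntegrable f := (Lp.memLp f).locallyIntegrable (by norm_num)

/-- This is the criterion by which Φ(ξ) is recognized as an element of the path space. -/
theorem hasWeakDeriv_of_sub_eq_integral {f v : L2R H} {u : ℝ → H}
    (huf : u =ᵐ[volume] f) (hu : ∀ a b, u b - u a = ∫ t in a..b, v t) : HasWeakDeriv f v := by
  intro θ hθ hc
  rw [← integral_inner_deriv_eq_neg (Lp_two_locallyIntegrable v) hu (hθ.of_le (by simp)) hc]
  refine integral_congr_ae ?_
  filter_upwards [huf] with t ht
  rw [ht]

/-- The primitive started to the left of the support vanishes again to its right because the total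
integral is zero. -/
theorem exists_primitive_of_integral_eq_zero {ψ : ℝ → ℝ} (hψ : ContDiff ℝ ∞ ψ)
    (hc : HasCompactSupport ψ) (h0 : ∫ t, ψ t = 0) :
    ∃ θ : ℝ → ℝ, ContDiff ℝ ∞ θ ∧ HasCompactSupport θ ∧ deriv θ = ψ := by
  obtain ⟨R, hR, hsub⟩ := exists_tsupport_subset_Ioo hc
  have hz : ∀ x, x ∉ Ioo (-R) R → ψ x = 0 := fun x hx =>
    image_eq_zero_of_notMem_tsupport fun h' => hx (hsub h')
  have hd : ∀ t, HasDerivAt (fun t => ∫ r in (-R)..t, ψ r) (ψ t) t := fun t =>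
    (hψ.continuous.integral_hasStrictDerivAt _ _).hasDerivAt
  have hde : deriv (fun t => ∫ r in (-R)..t, ψ r) = ψ := funext fun t => (hd t).deriv
  refine ⟨fun t => ∫ r in (-R)..t, ψ r, ?_, ?_, hde⟩
  · rw [contDiff_infty_iff_deriv, hde]
    exact ⟨fun t => (hd t).differentiableAt, hψ⟩
  · refine HasCompactSupport.intro (isCompact_Icc (a := -R) (b := R)) fun t ht => ?_
    rcases lt_or_ge t (-R) with h | h
    · rw [intervalIntegral.integral_congr (g := fun _ => 0), intervalIntegral.integral_zero]
      intro r hr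
      rw [uIcc_of_ge h.le] at hr
      exact hz r fun h' => by linarith [h'.1, hr.2]
    · have htR : R < t := by
        by_contra h'
        exact ht ⟨h, not_lt.1 h'⟩
      change ∫ r in (-R)..t, ψ r = 0
      rw [intervalIntegral.integral_eq_integral_of_support_subset, h0]
      intro x hx
      by_contra hx'
      exact hx (hz x fun h' => hx' ⟨h'.1, h'.2.le.trans htR.le⟩)

/-- The lemma of du Bois-Reymond. -/
theorem ae_eq_const_of_forall_integral_inner_deriv_eq_zero {h : ℝ → H}
    (hh : LocallyIntegrable h)
    (h0 : ∀ θ : ℝ → H, ContDiff ℝ ∞ θ → HasCompactSupport θ →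
      ∫ t, inner ℝ (h t) (deriv θ t) = 0) : ∃ c, ∀ᵐ t, h t = c := by
  have hsc : ∀ ψ : ℝ → ℝ, ContDiff ℝ ∞ ψ → HasCompactSupport ψ → ∫ t, ψ t = 0 →
      ∫ t, ψ t • h t = 0 := by
    intro ψ hψ hc hi
    obtain ⟨θ, hθ, hθc, rfl⟩ := exists_primitive_of_integral_eq_zero hψ hc hi
    have hint : Integrable (fun t => deriv θ t • h t) :=
      hh.integrable_smul_left_of_hasCompactSupport hψ.continuous hc
    refine ext_inner_left ℝ fun c => ?_
    rw [inner_zero_right, ← integral_inner hint c, ← h0 (fun t => θ t • c)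
      (hθ.smul contDiff_const) hθc.smul_right]
    refine integral_congr_ae (Eventually.of_forall fun t => ?_)
    have : deriv (fun t => θ t • c) t = deriv θ t • c :=
      ((hθ.differentiable (by simp) t).hasDerivAt.smul_const c).deriv
    simp only [this, inner_smul_right, real_inner_comm]
  let b : ContDiffBump (0 : ℝ) := default
  set ρ : ℝ → ℝ := b.normed volume with hρ
  have hρs : ContDiff ℝ ∞ ρ := b.contDiff_normed
  have hρc : HasCompactSupport ρ := b.hasCompactSupport_normed
  have hρi : ∫ t, ρ t = 1 := b.integral_normed
  refine ⟨∫ t, ρ t • h t, ?_⟩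
  set c := ∫ t, ρ t • h t with hc
  have key : ∀ᵐ t, h t - c = 0 := by
    refine ae_eq_zero_of_integral_contDiff_smul_eq_zero
      (hh.sub (locallyIntegrable_const c)) fun ψ hψ hψc => ?_
    have hψi : Integrable ψ := hψ.continuous.integrable_of_hasCompactSupport hψc
    have hρi' : Integrable ρ := hρs.continuous.integrable_of_hasCompactSupport hρc
    have h1 : Integrable (fun t => ψ t • h t) :=
      hh.integrable_smul_left_of_hasCompactSupport hψ.continuous hψc
    have h2 : Integrable (fun t => ρ t • h t) :=
      hh.integrable_smul_left_of_hasCompactSupport hρs.continuous hρc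
    have h2' : Integrable (fun t => (∫ r, ψ r) • ρ t • h t) := h2.smul _
    -- Subtracting a multiple of the unit-mass bump ρ makes an arbitrary test function mean-zero, so
    -- testing h against ψ only sees ∫ψ times the ρ-average of h.
    have h3 := hsc (fun t => ψ t - (∫ r, ψ r) * ρ t) (hψ.sub (contDiff_const.mul hρs))
      (hψc.sub (hρc.mul_left)) (by
        rw [integral_sub hψi (hρi'.const_mul _), integral_const_mul, hρi, mul_one, sub_self])
    simp_rw [sub_smul, mul_smul] at h3
    rw [integral_sub h1 h2', integral_smul, ← hc] at h3
    simp only [smul_sub]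
    rw [integral_sub h1 (hψi.smul_const c), integral_smul_const, h3]
  filter_upwards [key] with t ht using sub_eq_zero.1 ht

/-- The difference of f and a primitive of v has weak derivative zero, so it is constant by du
Bois-Reymond. -/
theorem HasWeakDeriv.exists_sub_eq_integral {f v : L2R H} (h : HasWeakDeriv f v) :
    ∃ u : ℝ → H, u =ᵐ[volume] f ∧ ∀ a b, u b - u a = ∫ t in a..b, v t := by
  have hv := Lp_two_locallyIntegrable v
  have hf := Lp_two_locallyIntegrable f
  have hvi : ∀ a b, IntervalIntegrable v volume a b := fun a b =>
    (hv.integrableOn_isCompact isCompact_uIcc).intervalIntegrable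
  set g : ℝ → H := fun t => ∫ r in (0 : ℝ)..t, v r with hg
  have hgs : ∀ a b, g b - g a = ∫ t in a..b, v t := fun a b =>
    intervalIntegral.integral_interval_sub_left (hvi _ _) (hvi _ _)
  have hgc : Continuous g := continuous_of_sub_eq_integral hv hgs
  obtain ⟨c, hc⟩ := ae_eq_const_of_forall_integral_inner_deriv_eq_zero
    (h := fun t => f t - g t) (hf.sub hgc.locallyIntegrable) fun θ hθ hθc => by
      have hθ' : Continuous (deriv θ) := hθ.continuous_deriv (by simp)
      simp_rw [inner_sub_left]
      rw [integral_sub (integrable_inner_deriv_test f hθ hθc), h θ hθ hθc,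
        integral_inner_deriv_eq_neg hv hgs (hθ.of_le (by simp)) hθc, sub_self]
      exact (hgc.inner hθ').integrable_of_hasCompactSupport
        (hθc.deriv.mono fun x hx hx' => hx (by simp [hx']))
  refine ⟨fun t => g t + c, ?_, fun a b => by rw [← hgs, add_sub_add_right_eq_sub]⟩
  filter_upwards [hc] with t ht
  rw [← ht]; abel

theorem integrable_inner_Lp_two {H : Type*} [NormedAddCommGroup H] [InnerProductSpace ℝ H]
    (f g : L2R H) : Integrable (fun t => inner ℝ (f t) (g t)) :=
  L2.integrable_inner (𝕜 := ℝ) f g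

theorem norm_sq_sub_eq_integral {u v : ℝ → H} (hv : LocallyIntegrable v)
    (hu : ∀ a b, u b - u a = ∫ t in a..b, v t) {a b : ℝ} (hab : a ≤ b) :
    ‖u b‖ ^ 2 - ‖u a‖ ^ 2 = ∫ t in a..b, 2 * inner ℝ (u t) (v t) := by
  have huc := continuous_of_sub_eq_integral hv hu
  have h := sub_eq_integral_of_hasFDerivAt hv hu (φ := fun p => ‖p.2‖ ^ 2)
    (φ' := fun p => ((2 : ℕ) • innerSL ℝ p.2).comp (.snd ℝ ℝ H))
    (fun t => ((hasStrictFDerivAt_norm_sq (u t)).hasFDerivAt.comp (f := Prod.snd) (t, u t) hasFDerivAt_snd))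
    (((innerSL ℝ).continuous.comp huc).const_smul (2 : ℕ) |>.clm_comp continuous_const) hab
  rw [h]
  refine intervalIntegral.integral_congr fun t _ => ?_
  simp

/-- The Sobolev embedding `W^{1,2}(ℝ, H) → C₀(ℝ, H)`. -/
theorem HasWeakDeriv.exists_zeroAtInfty {f v : L2R H} (h : HasWeakDeriv f v) :
    ∃ u : ZeroAtInftyContinuousMap ℝ H, (u : ℝ → H) =ᵐ[volume] f ∧
      (∀ a b, u b - u a = ∫ t in a..b, v t) ∧ ∀ t, ‖u t‖ ^ 2 ≤ 2 * (‖f‖ * ‖v‖) := by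
  obtain ⟨u, huf, hu⟩ := h.exists_sub_eq_integral
  have hv := Lp_two_locallyIntegrable v
  have huc := continuous_of_sub_eq_integral hv hu
  have hi : Integrable (fun t => 2 * inner ℝ (u t) (v t)) := by
    refine ((integrable_inner_Lp_two f v).const_mul 2).congr ?_
    filter_upwards [huf] with t ht
    rw [ht]
  have hsq : Integrable (fun t => ‖u t‖ ^ 2) := by
    refine ((Lp.memLp f).integrable_norm_pow (by norm_num)).congr ?_
    filter_upwards [huf] with t ht
    simp [ht]
  have htop : Tendsto (fun t => ‖u t‖ ^ 2) atTop
      (𝓝 (‖u 0‖ ^ 2 + ∫ t in Ioi (0 : ℝ), 2 * inner ℝ (u t) (v t))) := by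
    have := (intervalIntegral_tendsto_integral_Ioi 0 hi.integrableOn tendsto_id).const_add
      (‖u 0‖ ^ 2)
    refine this.congr' ?_
    filter_upwards [eventually_ge_atTop 0] with t ht
    rw [id, ← norm_sq_sub_eq_integral hv hu ht]; ring
  have hbot : ∀ b, Tendsto (fun t => ‖u t‖ ^ 2) atBot
      -- The base point b stays arbitrary: once the limit at -∞ is known to be 0, this formula
      -- represents ‖u b‖² as an integral, which Cauchy-Schwarz bounds.
      (𝓝 (‖u b‖ ^ 2 - ∫ t in Iic b, 2 * inner ℝ (u t) (v t))) := fun b => by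
    have := (intervalIntegral_tendsto_integral_Iic b hi.integrableOn tendsto_id).const_sub
      (‖u b‖ ^ 2)
    refine this.congr' ?_
    filter_upwards [eventually_le_atBot b] with t ht
    rw [id, ← norm_sq_sub_eq_integral hv hu ht]; ring
  -- An integrable function with a limit at infinity has limit zero there.
  have htop0 := IntegrableAtFilter.eq_zero_of_tendsto (hsq.integrableAtFilter _) (fun s hs => by
    obtain ⟨b, hb⟩ := mem_atTop_sets.1 hs
    exact measure_mono_top (show Ici b ⊆ s from hb) (by simp)) htop
  have hbot0 := fun b => IntegrableAtFilter.eq_zero_of_tendsto (hsq.integrableAtFilter _)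
    (fun s hs => by
      obtain ⟨b, hb⟩ := mem_atBot_sets.1 hs
      exact measure_mono_top (show Iic b ⊆ s from hb) (by simp)) (hbot b)
  rw [htop0] at htop
  have hbot1 := hbot 0
  rw [hbot0] at hbot1
  have hlim : Tendsto u (cocompact ℝ) (𝓝 0) := by
    have : Tendsto (fun t => ‖u t‖ ^ 2) (cocompact ℝ) (𝓝 0) := by
      rw [cocompact_eq_atBot_atTop]; exact hbot1.sup htop
    have h2 := this.sqrt
    simp only [Real.sqrt_sq (norm_nonneg _), Real.sqrt_zero] at h2
    exact tendsto_zero_iff_norm_tendsto_zero.2 h2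
  refine ⟨⟨⟨u, huc⟩, hlim⟩, huf, hu, fun t => ?_⟩
  change ‖u t‖ ^ 2 ≤ _
  rw [sub_eq_zero.1 (hbot0 t)]
  calc ∫ r in Iic t, 2 * inner ℝ (u r) (v r)
      ≤ ∫ r in Iic t, ‖2 * inner ℝ (u r) (v r)‖ :=
        integral_mono hi.integrableOn hi.norm.integrableOn fun r => Real.le_norm_self _
    _ ≤ ∫ r, ‖2 * inner ℝ (u r) (v r)‖ :=
        setIntegral_le_integral hi.norm (Eventually.of_forall fun _ => norm_nonneg _)
    _ ≤ ∫ r, 2 * (‖f r‖ * ‖v r‖) := by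
        refine integral_mono_ae hi.norm ?_ ?_
        · exact ((Lp.memLp f).norm.integrable_mul (Lp.memLp v).norm).const_mul 2
        · filter_upwards [huf] with r hr
          rw [hr, norm_mul, Real.norm_ofNat]
          gcongr
          exact norm_inner_le_norm _ _
    _ = 2 * ∫ r, ‖f r‖ * ‖v r‖ := integral_const_mul _ _
    _ ≤ 2 * (‖f‖ * ‖v‖) := by
        gcongr
        have := real_inner_le_norm (Lp.memLp f).norm.toLp (Lp.memLp v).norm.toLp
        rw [L2.inner_def, Lp.norm_toLp, Lp.norm_toLp, eLpNorm_norm, eLpNorm_norm, ← Lp.norm_def,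
          ← Lp.norm_def] at this
        refine le_trans (le_of_eq (integral_congr_ae ?_)) this
        filter_upwards [(Lp.memLp f).norm.coeFn_toLp, (Lp.memLp v).norm.coeFn_toLp] with r h1 h2
        simp [h1, h2, mul_comm]

end WeakDerivative

/-! ### Superposition operators on C₀ and multiplication operators on L² -/

section Nemytskii

/-- The retraction of `ℝ` onto `[-T, T]`. -/
def clamp (T s : ℝ) : ℝ := max (-T) (min s T)

theorem continuous_clamp (T : ℝ) : Continuous (clamp T) :=
  continuous_const.max (continuous_id.min continuous_const)

theorem clamp_of_le {T s : ℝ} (hT : 0 < T) (h : T ≤ s) : clamp T s = T := by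
  rw [clamp, min_eq_right h, max_eq_right (by linarith)]

theorem clamp_of_le_neg {T s : ℝ} (hT : 0 < T) (h : s ≤ -T) : clamp T s = -T := by
  rw [clamp, min_eq_left (by linarith), max_eq_left h]

theorem clamp_of_abs_le {T s : ℝ} (h : |s| ≤ T) : clamp T s = s := by
  rw [clamp, min_eq_left (abs_le.1 h).2, max_eq_right (abs_le.1 h).1]

theorem le_abs_clamp {T s : ℝ} (hT : 0 < T) (h : T ≤ |s|) : T ≤ |clamp T s| := by
  rcases le_abs.1 h with h | h
  · rw [clamp_of_le hT h]; exact le_abs_self T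
  · rw [clamp_of_le_neg hT (by linarith), abs_neg]; exact le_abs_self T

variable {H E : Type*} [NormedAddCommGroup H] [NormedSpace ℝ H]
  [NormedAddCommGroup E] [NormedSpace ℝ E]

/-- An open set `O ⊆ ℝ × H` whose slices are constant on both ends `s ≤ -T` and `s ≥ T`, where
they contain `0`. -/
structure IsEndConstantDomain {H : Type*} [NormedAddCommGroup H] (T : ℝ) (O : Set (ℝ × H)) :
    Prop where
  pos : 0 < T
  isOpen : IsOpen O
  mem_iff : ∀ s x, (s, x) ∈ O ↔ (clamp T s, x) ∈ O
  zero_mem : ∀ s, T ≤ |s| → (s, 0) ∈ O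

/-- The slices of `f` are constant on both ends `s ≤ -T` and `s ≥ T`. -/
def IsEndConstant {H E : Type*} (T : ℝ) (O : Set (ℝ × H)) (f : ℝ × H → E) : Prop :=
  ∀ s x, (s, x) ∈ O → f (s, x) = f (clamp T s, x)

/-- The curves in `C₀(ℝ, H)` whose graph lies in `O`. -/
def graphDomain {H : Type*} [NormedAddCommGroup H] (O : Set (ℝ × H)) : Set C₀(ℝ, H) :=
  {u | ∀ s, (s, u s) ∈ O}

variable {T : ℝ} {O : Set (ℝ × H)}

/-- As s → ±∞ the clamped graph converges to (±T, 0), which lies in `O`. Adding these two limit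
points makes it compact. -/
theorem IsEndConstantDomain.exists_isCompact {H : Type*} [NormedAddCommGroup H]
    {O : Set (ℝ × H)} (hO : IsEndConstantDomain T O) {u : C₀(ℝ, H)}
    (hu : u ∈ graphDomain O) : ∃ K, IsCompact K ∧ K ⊆ O ∧ ∀ s, (clamp T s, u s) ∈ K := by
  have hT := hO.pos
  have hcu : Continuous fun s => (clamp T s, u s) :=
    (continuous_clamp T).prodMk u.continuous
  have habs : Tendsto (fun s : ℝ => |s|) (cocompact ℝ) atTop := tendsto_norm_cocompact_atTop
  have hu0 := zero_at_infty u
  rw [cocompact_eq_atBot_atTop] at hu0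
  -- Replacing s by ±|s| folds each half-line onto all of ℝ, so that each half of the graph has a
  -- single limit along the cocompact filter.
  have h1 : Tendsto (fun s : ℝ => (clamp T |s|, u |s|)) (cocompact ℝ) (𝓝 (T, 0)) := by
    refine Tendsto.prodMk_nhds ?_ ((hu0.mono_left le_sup_right).comp habs)
    refine tendsto_const_nhds.congr' ?_
    filter_upwards [habs.eventually_ge_atTop T] with s hs
    rw [clamp_of_le hT hs]
  have h2 : Tendsto (fun s : ℝ => (clamp T (-|s|), u (-|s|))) (cocompact ℝ) (𝓝 (-T, 0)) := by
    refine Tendsto.prodMk_nhds ?_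
      ((hu0.mono_left le_sup_left).comp (tendsto_neg_atTop_atBot.comp habs))
    refine tendsto_const_nhds.congr' ?_
    filter_upwards [habs.eventually_ge_atTop T] with s hs
    rw [clamp_of_le_neg hT (by linarith)]
  refine ⟨_, (h1.isCompact_insert_range_of_cocompact (hcu.comp continuous_abs)).union
    (h2.isCompact_insert_range_of_cocompact (hcu.comp continuous_abs.neg)), ?_, fun s => ?_⟩
  · refine union_subset (insert_subset ?_ ?_) (insert_subset ?_ ?_)
    · exact hO.zero_mem T (le_abs_self T)
    · rintro _ ⟨s, rfl⟩
      exact (hO.mem_iff _ _).1 (hu _)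
    · exact hO.zero_mem (-T) (by rw [abs_neg]; exact le_abs_self T)
    · rintro _ ⟨s, rfl⟩
      exact (hO.mem_iff _ _).1 (hu _)
  · rcases le_total 0 s with h | h
    · exact Or.inl (Or.inr ⟨s, by simp [abs_of_nonneg h]⟩)
    · exact Or.inr (Or.inr ⟨s, by simp [abs_of_nonpos h]⟩)

theorem dist_prodMk_right {X Y : Type*} [PseudoMetricSpace X] [PseudoMetricSpace Y] (x : X)
    (y z : Y) : dist (x, y) (x, z) = dist y z := by
  rw [Prod.dist_eq, dist_self, max_eq_right dist_nonneg]

theorem ZeroAtInftyContinuousMap.dist_apply_le {H : Type*} [NormedAddCommGroup H]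
    (u v : C₀(ℝ, H)) (s : ℝ) : dist (u s) (v s) ≤ dist u v :=
  BoundedContinuousFunction.dist_coe_le_dist (f := u.toBCF) (g := v.toBCF) s

theorem ZeroAtInftyContinuousMap.norm_apply_le {H : Type*} [NormedAddCommGroup H]
    (u : C₀(ℝ, H)) (s : ℝ) : ‖u s‖ ≤ ‖u‖ :=
  BoundedContinuousFunction.norm_coe_le_norm u.toBCF s

/-- A neighbourhood of the graph of a curve on which all nearby graphs lie. -/
theorem IsEndConstantDomain.exists_ball_subset {H : Type*} [NormedAddCommGroup H]
    {O : Set (ℝ × H)} (hO : IsEndConstantDomain T O) {u : C₀(ℝ, H)}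
    (hu : u ∈ graphDomain O) :
    ∃ δ > 0, ∀ s x, dist x (u s) < δ → (clamp T s, x) ∈ O ∧ (s, x) ∈ O := by
  obtain ⟨K, hK, hKO, hKu⟩ := hO.exists_isCompact hu
  obtain ⟨δ, hδ, hsub⟩ := hK.exists_thickening_subset_open hO.isOpen hKO
  refine ⟨δ, hδ, fun s x hx => ?_⟩
  have h : (clamp T s, x) ∈ O := hsub (Metric.mem_thickening_iff.2
    ⟨_, hKu s, by rwa [dist_prodMk_right]⟩)
  exact ⟨h, (hO.mem_iff s x).2 h⟩

theorem IsEndConstantDomain.isOpen_graphDomain {H : Type*} [NormedAddCommGroup H]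
    {O : Set (ℝ × H)} (hO : IsEndConstantDomain T O) : IsOpen (graphDomain O) := by
  refine Metric.isOpen_iff.2 fun u hu => ?_
  obtain ⟨δ, hδ, h⟩ := hO.exists_ball_subset hu
  exact ⟨δ, hδ, fun v hv s => (h s (v s)
    ((ZeroAtInftyContinuousMap.dist_apply_le v u s).trans_lt hv)).2⟩

open Classical in
/-- The Nemytskii operator `u ↦ [s ↦ f(s, u(s))]` with values in bounded continuous functions. -/
noncomputable def nemytskii {H E : Type*} [NormedAddCommGroup H] [NormedAddCommGroup E]
    (f : ℝ × H → E) (u : C₀(ℝ, H)) : ℝ →ᵇ E :=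
  if h : Continuous (fun s => f (s, u s)) ∧ ∃ C, ∀ s, ‖f (s, u s)‖ ≤ C then
    BoundedContinuousFunction.ofNormedAddCommGroup _ h.1 h.2.choose h.2.choose_spec
  else 0

theorem nemytskii_apply {H E : Type*} [NormedAddCommGroup H] [NormedAddCommGroup E]
    {O : Set (ℝ × H)} {f : ℝ × H → E} (hO : IsEndConstantDomain T O) (hf : ContinuousOn f O)
    (hfT : IsEndConstant T O f) {u : C₀(ℝ, H)} (hu : u ∈ graphDomain O) (s : ℝ) :
    nemytskii f u s = f (s, u s) := by
  have h : Continuous (fun s => f (s, u s)) ∧ ∃ C, ∀ s, ‖f (s, u s)‖ ≤ C := by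
    refine ⟨hf.comp_continuous (continuous_id.prodMk u.continuous) hu, ?_⟩
    obtain ⟨K, hK, hKO, hKu⟩ := hO.exists_isCompact hu
    obtain ⟨C, hC⟩ := hK.exists_bound_of_continuousOn (hf.mono hKO)
    exact ⟨C, fun s => by rw [hfT s _ (hu s)]; exact hC _ (hKu s)⟩
  rw [nemytskii, dif_pos h]
  rfl

/-- A continuous function is uniformly continuous at the points of a compact set, even against
nearby points outside it. This replaces local compactness, which H lacks in infinite dimensions. -/
theorem IsEndConstantDomain.uniform_dist_lt {H E : Type*} [NormedAddCommGroup H] [NormedAddCommGroup E]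
    {O : Set (ℝ × H)} {f : ℝ × H → E} (hO : IsEndConstantDomain T O)
    (hf : ContinuousOn f O) (hfT : IsEndConstant T O f) {u : C₀(ℝ, H)} (hu : u ∈ graphDomain O)
    {ε : ℝ} (hε : 0 < ε) :
    ∃ δ > 0, ∀ s x, dist x (u s) < δ → (s, x) ∈ O ∧ dist (f (s, x)) (f (s, u s)) < ε := by
  obtain ⟨K, hK, hKO, hKu⟩ := hO.exists_isCompact hu
  obtain ⟨δ₁, hδ₁, h₁⟩ := hO.exists_ball_subset hu
  obtain ⟨δ₂, hδ₂, h₂⟩ := Metric.mem_uniformity_dist.1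
    (hK.uniformContinuousAt_of_continuousAt f
      (fun p hp => hf.continuousAt (hO.isOpen.mem_nhds (hKO hp))) (Metric.dist_mem_uniformity hε))
  refine ⟨min δ₁ δ₂, lt_min hδ₁ hδ₂, fun s x hx => ?_⟩
  have hxO := (h₁ s x (hx.trans_le (min_le_left _ _))).2
  refine ⟨hxO, ?_⟩
  rw [hfT s _ (hu s), hfT s _ hxO, dist_comm]
  refine h₂ (a := (clamp T s, u s)) (b := (clamp T s, x)) ?_ (hKu s)
  rw [dist_prodMk_right, dist_comm]
  exact hx.trans_le (min_le_right _ _)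

theorem continuousOn_nemytskii {H E : Type*} [NormedAddCommGroup H] [NormedAddCommGroup E]
    {O : Set (ℝ × H)} {f : ℝ × H → E} (hO : IsEndConstantDomain T O)
    (hf : ContinuousOn f O) (hfT : IsEndConstant T O f) :
    ContinuousOn (nemytskii f) (graphDomain O) := by
  refine Metric.continuousOn_iff.2 fun u hu ε hε => ?_
  obtain ⟨δ, hδ, h⟩ := hO.uniform_dist_lt hf hfT hu (half_pos hε)
  refine ⟨δ, hδ, fun v hv hvu => ?_⟩
  refine lt_of_le_of_lt ?_ (half_lt_self hε)
  refine (BoundedContinuousFunction.dist_le (half_pos hε).le).2 fun s => ?_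
  rw [nemytskii_apply hO hf hfT hu, nemytskii_apply hO hf hfT hv]
  exact (h s (v s) ((ZeroAtInftyContinuousMap.dist_apply_le v u s).trans_lt hvu)).2.le

theorem norm_bcf_apply_le (B : ℝ →ᵇ (H →L[ℝ] E)) (x : H) (s : ℝ) : ‖B s x‖ ≤ ‖B‖ * ‖x‖ :=
  ((B s).le_opNorm _).trans (mul_le_mul_of_nonneg_right (B.norm_coe_le_norm s) (norm_nonneg _))

theorem norm_bcf_apply_zeroAtInfty_le (B : ℝ →ᵇ (H →L[ℝ] E)) (u : C₀(ℝ, H)) (s : ℝ) :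
    ‖B s (u s)‖ ≤ ‖B‖ * ‖u‖ :=
  (norm_bcf_apply_le B (u s) s).trans (by gcongr; exact u.norm_apply_le s)

theorem memLp_bcf_apply (B : ℝ →ᵇ (H →L[ℝ] E)) (η : L2R H) :
    MemLp (fun s => B s (η s)) 2 volume :=
  (Lp.memLp η).of_le_mul (c := ‖B‖)
    ((ContinuousLinearMap.id ℝ (H →L[ℝ] E)).aestronglyMeasurable_comp₂
      B.continuous.aestronglyMeasurable (Lp.aestronglyMeasurable η))
    (Eventually.of_forall fun s => norm_bcf_apply_le B _ s)

variable (H E) in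
/-- Pointwise application of operator valued functions. -/
noncomputable def bcfApply : (ℝ →ᵇ (H →L[ℝ] E)) →L[ℝ] C₀(ℝ, H) →L[ℝ] (ℝ →ᵇ E) :=
  LinearMap.mkContinuous₂ (LinearMap.mk₂ ℝ
    (fun (B : ℝ →ᵇ (H →L[ℝ] E)) (u : C₀(ℝ, H)) => BoundedContinuousFunction.ofNormedAddCommGroup (fun s => B s (u s))
      (B.continuous.clm_apply u.continuous) (‖B‖ * ‖u‖) (norm_bcf_apply_zeroAtInfty_le B u))
    (fun _ _ _ => by ext; simp) (fun _ _ _ => by ext; simp)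
    (fun _ _ _ => by ext; simp) (fun _ _ _ => by ext; simp)) 1 fun B u => by
      rw [one_mul]
      exact BoundedContinuousFunction.norm_ofNormedAddCommGroup_le _ (by positivity)
        (norm_bcf_apply_zeroAtInfty_le B u)

theorem bcfApply_apply (B : ℝ →ᵇ (H →L[ℝ] E)) (u : C₀(ℝ, H)) (s : ℝ) :
    bcfApply H E B u s = B s (u s) := rfl

theorem contDiffOn_one_of_hasFDerivAt {f : H → E} {s : Set H} (hs : IsOpen s)
    {f' : H → H →L[ℝ] E} (h : ∀ x ∈ s, HasFDerivAt f (f' x) x) (hc : ContinuousOn f' s) :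
    ContDiffOn ℝ 1 f s := by
  rw [show (1 : WithTop ℕ∞) = 0 + 1 from (zero_add 1).symm,
    contDiffOn_succ_iff_fderiv_of_isOpen hs]
  exact ⟨fun x hx => (h x hx).differentiableAt.differentiableWithinAt, by simp,
    contDiffOn_zero.2 (hc.congr fun x hx => (h x hx).fderiv)⟩

/-- The slice derivative, as a function of both variables. -/
noncomputable def sliceDeriv (f : ℝ × H → E) (p : ℝ × H) : H →L[ℝ] E :=
  (fderiv ℝ f p).comp (.inr ℝ ℝ H)

theorem hasFDerivAt_slice {f : ℝ × H → E} {s : ℝ} {x : H} (h : DifferentiableAt ℝ f (s, x)) :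
    HasFDerivAt (fun y => f (s, y)) (sliceDeriv f (s, x)) x :=
  h.hasFDerivAt.comp x (hasFDerivAt_prodMk_right s x)

/-- The slices of f at s and at the clamped time agree on a neighbourhood of x, so their derivatives
agree at x. -/
theorem sliceDeriv_isEndConstant {f : ℝ × H → E} (hO : IsEndConstantDomain T O)
    (hf : DifferentiableOn ℝ f O) (hfT : IsEndConstant T O f) :
    IsEndConstant T O (sliceDeriv f) := by
  intro s x hx
  have hx' := (hO.mem_iff s x).1 hx
  have h1 := hasFDerivAt_slice (hf.differentiableAt (hO.isOpen.mem_nhds hx))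
  have h2 := hasFDerivAt_slice (hf.differentiableAt (hO.isOpen.mem_nhds hx'))
  refine h1.unique (h2.congr_of_eventuallyEq ?_)
  have hc : ContinuousAt (fun y : H => (s, y)) x := by fun_prop
  filter_upwards [hc.preimage_mem_nhds (hO.isOpen.mem_nhds hx)] with y hy
  exact hfT s y hy

theorem ContDiffOn.continuousOn_sliceDeriv {f : ℝ × H → E} (hf : ContDiffOn ℝ 1 f O)
    (hO : IsOpen O) : ContinuousOn (sliceDeriv f) O :=
  (hf.continuousOn_fderiv_of_isOpen hO le_rfl).clm_comp continuousOn_const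

/-- The Nemytskii operator of a `C¹` map is `C¹`. -/
theorem contDiffOn_nemytskii {f : ℝ × H → E} (hO : IsEndConstantDomain T O)
    (hf : ContDiffOn ℝ 1 f O) (hfT : IsEndConstant T O f) :
    ContDiffOn ℝ 1 (nemytskii f) (graphDomain O) := by
  have hfd := hf.differentiableOn one_ne_zero
  have hgT := sliceDeriv_isEndConstant hO hfd hfT
  have hgc := hf.continuousOn_sliceDeriv hO.isOpen
  refine contDiffOn_one_of_hasFDerivAt hO.isOpen_graphDomain
    (f' := fun u => bcfApply H E (nemytskii (sliceDeriv f) u)) (fun u hu => ?_)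
    ((bcfApply H E).continuous.comp_continuousOn (continuousOn_nemytskii hO hgc hgT))
  refine HasFDerivAt.of_isLittleO (Asymptotics.isLittleO_iff.2 fun ε hε => ?_)
  obtain ⟨δ, hδ, h⟩ := hO.uniform_dist_lt hgc hgT hu hε
  filter_upwards [Metric.ball_mem_nhds u hδ, hO.isOpen_graphDomain.mem_nhds hu] with v hv hvO
  refine (BoundedContinuousFunction.norm_le (by positivity)).2 fun s => ?_
  rw [BoundedContinuousFunction.sub_apply, BoundedContinuousFunction.sub_apply, bcfApply_apply,
    nemytskii_apply hO hf.continuousOn hfT hu, nemytskii_apply hO hf.continuousOn hfT hvO,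
    nemytskii_apply hO hgc hgT hu, ZeroAtInftyContinuousMap.sub_apply]
  have hvs : v s ∈ Metric.ball (u s) δ :=
    (ZeroAtInftyContinuousMap.dist_apply_le v u s).trans_lt hv
  -- Mean value inequality on the slice ball about `u s`, whose radius δ does not depend on s; this
  -- is what makes the remainder small in the sup norm.
  refine ((convex_ball (u s) δ).norm_image_sub_le_of_norm_hasFDerivWithin_le'
    (f := fun x => f (s, x)) (f' := fun x => sliceDeriv f (s, x)) (C := ε)
    (fun x hx => (hasFDerivAt_slice (hfd.differentiableAt
      (hO.isOpen.mem_nhds (h s x hx).1))).hasFDerivWithinAt)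
    (fun x hx => by rw [← dist_eq_norm]; exact (h s x hx).2.le)
    (Metric.mem_ball_self hδ) hvs).trans ?_
  gcongr
  exact (v - u).norm_apply_le s

variable (H E) in
/-- Multiplication of an `L²` function with a bounded continuous operator valued function. -/
noncomputable def mulL2 : (ℝ →ᵇ (H →L[ℝ] E)) →L[ℝ] L2R H →L[ℝ] L2R E :=
  LinearMap.mkContinuous₂ (LinearMap.mk₂ ℝ
    (fun (B : ℝ →ᵇ (H →L[ℝ] E)) (η : L2R H) => (memLp_bcf_apply B η).toLp)
    (fun B C η => by
      rw [← MemLp.toLp_add]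
      exact MemLp.toLp_congr _ _ (Eventually.of_forall fun s => by simp))
    (fun c B η => by
      rw [← MemLp.toLp_const_smul]
      exact MemLp.toLp_congr _ _ (Eventually.of_forall fun s => by simp))
    (fun B η θ => by
      rw [← MemLp.toLp_add]
      refine MemLp.toLp_congr _ _ ?_
      filter_upwards [Lp.coeFn_add η θ] with s hs
      rw [hs, Pi.add_apply, map_add, Pi.add_apply])
    (fun c B η => by
      rw [← MemLp.toLp_const_smul]
      refine MemLp.toLp_congr _ _ ?_
      filter_upwards [Lp.coeFn_smul c η] with s hs
      rw [hs, Pi.smul_apply, map_smul, Pi.smul_apply])) 1 fun B η => by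
        rw [one_mul]
        refine Lp.norm_le_mul_norm_of_ae_le_mul ?_
        filter_upwards [(memLp_bcf_apply B η).coeFn_toLp] with s hs
        simp only [LinearMap.mk₂_apply, hs]
        exact norm_bcf_apply_le B _ s

theorem coeFn_mulL2 (B : ℝ →ᵇ (H →L[ℝ] E)) (η : L2R H) :
    mulL2 H E B η =ᵐ[volume] fun s => B s (η s) :=
  (memLp_bcf_apply B η).coeFn_toLp

end Nemytskii

/-! ### The path space: closedness and continuous representatives -/

section PathSpace

variable {H₁ H₂ : Type*} [NormedAddCommGroup H₁] [InnerProductSpace ℝ H₁]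
  [NormedAddCommGroup H₂] [InnerProductSpace ℝ H₂] (ι : H₂ →L[ℝ] H₁)

/-- Each test function imposes a closed condition, being an equality of L²-continuous functionals.
Closedness gives completeness, hence an orthogonal projection onto the path space. -/
theorem isClosed_pathSpace : IsClosed (pathSpace ι : Set (WithLp 2 (L2R H₂ × L2R H₁))) := by
  have key : ∀ {θ : ℝ → H₁}, Continuous θ → HasCompactSupport θ →
      Continuous fun f : L2R H₁ => ∫ t, inner ℝ (f t) (θ t) := fun {θ} hθ hc => by
    have h2 : MemLp θ 2 (volume : Measure ℝ) := hθ.memLp_of_hasCompactSupport hc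
    have : (fun f : L2R H₁ => ∫ t, inner ℝ (f t) (θ t)) = fun f => inner ℝ f h2.toLp := by
      ext f
      rw [L2.inner_def]
      refine integral_congr_ae ?_
      filter_upwards [h2.coeFn_toLp] with t ht
      rw [ht]
    rw [this]
    exact continuous_id.inner continuous_const
  have hs : (pathSpace ι : Set (WithLp 2 (L2R H₂ × L2R H₁))) =
      ⋂ (θ : ℝ → H₁) (_ : ContDiff ℝ ∞ θ) (_ : HasCompactSupport θ),
        {p | ∫ t, inner ℝ (ι.compLpL 2 volume p.fst t) (deriv θ t)
          = - ∫ t, inner ℝ (p.snd t) (θ t)} := by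
    ext p
    simp only [mem_iInter]
    exact Iff.rfl
  rw [hs]
  refine isClosed_iInter fun θ => isClosed_iInter fun hθ => isClosed_iInter fun hc => ?_
  exact isClosed_eq
    ((key (hθ.continuous_deriv (by simp)) hc.deriv).comp
      ((ι.compLpL 2 volume).continuous.comp (continuous_fst.comp
        (WithLp.prodContinuousLinearEquiv 2 ℝ (L2R H₂) (L2R H₁)).continuous)))
    ((key hθ.continuous hc).comp (continuous_snd.comp
        (WithLp.prodContinuousLinearEquiv 2 ℝ (L2R H₂) (L2R H₁)).continuous)).neg

variable [CompleteSpace H₁]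

theorem exists_pathRep (ξ : pathSpace ι) : ∃ u : C₀(ℝ, H₁),
    (u : ℝ → H₁) =ᵐ[volume] (fun s => ι (ξ.1.fst s)) ∧
    (∀ a b, u b - u a = ∫ t in a..b, ξ.1.snd t) ∧ ∀ t, ‖u t‖ ≤ (1 + ‖ι‖) * ‖ξ‖ := by
  obtain ⟨u, hu, hs, hb⟩ := HasWeakDeriv.exists_zeroAtInfty ξ.2
  refine ⟨u, hu.trans (ι.coeFn_compLpL _), hs, fun t => ?_⟩
  have hn : ‖ξ‖ ^ 2 = ‖ξ.1.fst‖ ^ 2 + ‖ξ.1.snd‖ ^ 2 := WithLp.prod_norm_sq_eq_of_L2 ξ.1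
  have h1 : ‖ξ.1.fst‖ ≤ ‖ξ‖ := by
    refine le_of_sq_le_sq ?_ (norm_nonneg _); nlinarith [sq_nonneg ‖ξ.1.snd‖]
  have h2 : ‖ξ.1.snd‖ ≤ ‖ξ‖ := by
    refine le_of_sq_le_sq ?_ (norm_nonneg _); nlinarith [sq_nonneg ‖ξ.1.fst‖]
  have h3 : ‖ι.compLpL 2 volume ξ.1.fst‖ ≤ ‖ι‖ * ‖ξ‖ :=
    (ι.norm_compLp_le _).trans (by gcongr)
  refine le_of_sq_le_sq ?_ (by positivity)
  refine (hb t).trans ?_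
  calc 2 * (‖ι.compLpL 2 volume ξ.1.fst‖ * ‖ξ.1.snd‖) ≤ 2 * ((‖ι‖ * ‖ξ‖) * ‖ξ‖) := by gcongr
    -- The constant 1 + ‖ι‖ is a convenient upper bound for √(2‖ι‖), because (1 + a)² - 2a = 1 + a²
    -- ≥ 0.
    _ ≤ ((1 + ‖ι‖) * ‖ξ‖) ^ 2 := by
      nlinarith [mul_nonneg (by positivity : 0 ≤ 1 + ‖ι‖ ^ 2) (sq_nonneg ‖ξ‖)]

/-- The continuous representative, as a continuous linear map to `C₀(ℝ, H₁)`. -/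
noncomputable def pathRep : pathSpace ι →L[ℝ] C₀(ℝ, H₁) :=
  LinearMap.mkContinuous
    { toFun := fun ξ => (exists_pathRep ι ξ).choose
      map_add' := fun ξ η => by
        refine DFunLike.coe_injective ((ContinuousMapClass.map_continuous _).ae_eq_iff_eq volume
          (ContinuousMapClass.map_continuous _) |>.1 ?_)
        have h : ((ξ + η : pathSpace ι).1.fst : ℝ → H₂) =ᵐ[volume] ξ.1.fst + η.1.fst :=
          Lp.coeFn_add ξ.1.fst η.1.fst
        filter_upwards [(exists_pathRep ι (ξ + η)).choose_spec.1,
          (exists_pathRep ι ξ).choose_spec.1, (exists_pathRep ι η).choose_spec.1, h]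
          with s h1 h2 h3 h4
        rw [h1, h4, ZeroAtInftyContinuousMap.add_apply, h2, h3, Pi.add_apply, map_add]
      map_smul' := fun c ξ => by
        refine DFunLike.coe_injective ((ContinuousMapClass.map_continuous _).ae_eq_iff_eq volume
          (ContinuousMapClass.map_continuous _) |>.1 ?_)
        have h : ((c • ξ : pathSpace ι).1.fst : ℝ → H₂) =ᵐ[volume] c • ⇑ξ.1.fst :=
          Lp.coeFn_smul c ξ.1.fst
        filter_upwards [(exists_pathRep ι (c • ξ)).choose_spec.1,
          (exists_pathRep ι ξ).choose_spec.1, h] with s h1 h2 h3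
        rw [h1, h3, RingHom.id_apply, ZeroAtInftyContinuousMap.smul_apply, h2, Pi.smul_apply,
          map_smul] } (1 + ‖ι‖) fun ξ => by
    rw [← ZeroAtInftyContinuousMap.norm_toBCF_eq_norm]
    exact (BoundedContinuousFunction.norm_le (by positivity)).2
      (exists_pathRep ι ξ).choose_spec.2.2

theorem pathRep_ae_eq (ξ : pathSpace ι) :
    (pathRep ι ξ : ℝ → H₁) =ᵐ[volume] fun s => ι (ξ.1.fst s) :=
  (exists_pathRep ι ξ).choose_spec.1

theorem pathRep_sub_eq_integral (ξ : pathSpace ι) (a b : ℝ) :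
    pathRep ι ξ b - pathRep ι ξ a = ∫ t in a..b, ξ.1.snd t :=
  (exists_pathRep ι ξ).choose_spec.2.1 a b

variable {ι}

theorem norm_pathRep_apply_le (ξ : pathSpace ι) (s : ℝ) :
    ‖pathRep ι ξ s‖ ≤ (1 + ‖ι‖) * ‖ξ‖ :=
  (exists_pathRep ι ξ).choose_spec.2.2 s

theorem IsContRep.eq_pathRep {ξ : pathSpace ι} {u : ℝ → H₁} (h : IsContRep ι ξ u) :
    u = pathRep ι ξ :=
  (h.1.ae_eq_iff_eq volume (pathRep ι ξ).continuous).1 (h.2.trans (pathRep_ae_eq ι ξ).symm)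

theorem isContRep_pathRep (ξ : pathSpace ι) : IsContRep ι ξ (pathRep ι ξ) :=
  ⟨(pathRep ι ξ).continuous, pathRep_ae_eq ι ξ⟩

theorem pathDomain_eq_preimage (O : Set (ℝ × H₁)) :
    pathDomain ι O = pathRep ι ⁻¹' graphDomain O := by
  ext ξ
  constructor
  · rintro ⟨u, hu, h⟩
    rw [hu.eq_pathRep] at h
    exact h
  · exact fun h => ⟨_, isContRep_pathRep ξ, h⟩

end PathSpace

/-! ### Consequences of the tame estimate on a slice -/

section Tame

variable {H₁ H₂ : Type*} [NormedAddCommGroup H₁] [InnerProductSpace ℝ H₁]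
  [NormedAddCommGroup H₂] [InnerProductSpace ℝ H₂] {ι : H₂ →L[ℝ] H₁}
  {O : Set (ℝ × H₁)} {φ₂ : ℝ × H₂ → H₂}

/-- The tame estimate holds, with constant `κ`, on the slice over `t` of the ball of radius `δ`
around `c`. -/
def IsTameOnBall (ι : H₂ →L[ℝ] H₁) (O : Set (ℝ × H₁)) (φ₂ : ℝ × H₂ → H₂) (t : ℝ) (c : H₁)
    (δ κ : ℝ) : Prop :=
  ∀ y, dist (ι y) c < δ → (t, ι y) ∈ O ∧ ∀ ξ η : H₂,
    ‖fderiv ℝ (fderiv ℝ fun z => φ₂ (t, z)) y ξ η‖ ≤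
      κ * (‖ι ξ‖ * ‖η‖ + ‖ξ‖ * ‖ι η‖ + ‖y‖ * ‖ι ξ‖ * ‖ι η‖)

theorem IsTameOnBall.mono {t : ℝ} {c c' : H₁} {δ δ' κ κ' : ℝ}
    (h : IsTameOnBall ι O φ₂ t c δ κ) (hδ : δ' + dist c' c ≤ δ) (hκ : κ ≤ κ') :
    IsTameOnBall ι O φ₂ t c' δ' κ' := fun y hy => by
  have hy' : dist (ι y) c < δ := by linarith [dist_triangle (ι y) c' c]
  refine ⟨(h y hy').1, fun ξ η => ((h y hy').2 ξ η).trans ?_⟩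
  gcongr

theorem isOpen_restrictDomain (hO : IsOpen O) : IsOpen {p : ℝ × H₂ | (p.1, ι p.2) ∈ O} :=
  hO.preimage (by fun_prop : Continuous fun p : ℝ × H₂ => (p.1, ι p.2))

theorem hasFDerivAt_restriction (hO : IsOpen O)
    (hφ₂ : ContDiffOn ℝ 2 φ₂ {p | (p.1, ι p.2) ∈ O}) {t : ℝ} {y : H₂} (h : (t, ι y) ∈ O) :
    HasFDerivAt (fun z => φ₂ (t, z)) (sliceDeriv φ₂ (t, y)) y :=
  hasFDerivAt_slice ((hφ₂.differentiableOn two_ne_zero).differentiableAt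
    ((isOpen_restrictDomain hO).mem_nhds h))

theorem sliceDeriv_eq_fderiv (hO : IsOpen O)
    (hφ₂ : ContDiffOn ℝ 2 φ₂ {p | (p.1, ι p.2) ∈ O}) {t : ℝ} {y : H₂} (h : (t, ι y) ∈ O) :
    sliceDeriv φ₂ (t, y) = fderiv ℝ (fun z => φ₂ (t, z)) y :=
  (hasFDerivAt_restriction hO hφ₂ h).fderiv.symm

/-- Near y the slice derivative is the `fderiv` of the slice, so its derivative is the iterated one
occurring in the tame estimate. -/
theorem hasFDerivAt_sliceDeriv (hO : IsOpen O)
    (hφ₂ : ContDiffOn ℝ 2 φ₂ {p | (p.1, ι p.2) ∈ O}) {t : ℝ} {y : H₂} (h : (t, ι y) ∈ O) :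
    HasFDerivAt (fun z => sliceDeriv φ₂ (t, z))
      (fderiv ℝ (fderiv ℝ fun z => φ₂ (t, z)) y) y := by
  have hopen := isOpen_restrictDomain (ι := ι) hO
  have hd : DifferentiableAt ℝ (sliceDeriv φ₂) (t, y) := by
    have h1 : DifferentiableOn ℝ (fderiv ℝ φ₂) {p | (p.1, ι p.2) ∈ O} :=
      (hφ₂.fderiv_of_isOpen hopen (m := 1) (by norm_num)).differentiableOn one_ne_zero
    exact (h1.differentiableAt (hopen.mem_nhds h)).clm_comp (differentiableAt_const _)
  have h2 : DifferentiableAt ℝ (fun z => sliceDeriv φ₂ (t, z)) y :=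
    hd.comp y (hasFDerivAt_prodMk_right t y).differentiableAt
  have hc : ContinuousAt (fun z : H₂ => (t, z)) y := by fun_prop
  have heq : (fun z => sliceDeriv φ₂ (t, z)) =ᶠ[𝓝 y] fderiv ℝ fun z => φ₂ (t, z) := by
    filter_upwards [hc.preimage_mem_nhds (hopen.mem_nhds h)] with z hz
    exact sliceDeriv_eq_fderiv hO hφ₂ hz
  rw [← heq.fderiv_eq]
  exact h2.hasFDerivAt

theorem segment_mem_ball {c : H₁} {δ : ℝ} {y y' : H₂} (hy : dist (ι y) c < δ)
    (hy' : dist (ι y') c < δ) {τ : ℝ} (hτ : τ ∈ Icc (0 : ℝ) 1) :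
    dist (ι (y + τ • (y' - y))) c < δ := by
  have := (convex_ball c δ).add_smul_sub_mem hy hy' hτ
  simpa using this

theorem norm_segment_le (y y' : H₂) {τ : ℝ} (hτ : τ ∈ Icc (0 : ℝ) 1) :
    ‖y + τ • (y' - y)‖ ≤ ‖y‖ + ‖y'‖ := by
  have : y + τ • (y' - y) = (1 - τ) • y + τ • y' := by module
  rw [this]
  refine (norm_add_le _ _).trans ?_
  rw [norm_smul, norm_smul, Real.norm_of_nonneg hτ.1, Real.norm_of_nonneg (by linarith [hτ.2])]
  nlinarith [norm_nonneg y, norm_nonneg y', hτ.1, hτ.2]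

theorem hasDerivAt_segment (y y' : H₂) (τ : ℝ) :
    HasDerivAt (fun τ : ℝ => y + τ • (y' - y)) (y' - y) τ := by
  simpa using ((hasDerivAt_id τ).smul_const (y' - y)).const_add y

/-- Mean value inequality along the segment from y to y', which stays in the H₁-ball by convexity.
The H₂ norm of an intermediate point is at most ‖y‖ + ‖y'‖. -/
theorem IsTameOnBall.norm_sliceDeriv_sub_le (hO : IsOpen O)
    (hφ₂ : ContDiffOn ℝ 2 φ₂ {p | (p.1, ι p.2) ∈ O}) {t : ℝ} {c : H₁} {δ κ : ℝ} (hκ : 0 ≤ κ)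
    (h : IsTameOnBall ι O φ₂ t c δ κ) {y y' : H₂} (hy : dist (ι y) c < δ)
    (hy' : dist (ι y') c < δ) (η : H₂) :
    ‖sliceDeriv φ₂ (t, y') η - sliceDeriv φ₂ (t, y) η‖ ≤
      κ * (‖ι (y' - y)‖ * ‖η‖ + ‖y' - y‖ * ‖ι η‖
        + (‖y‖ + ‖y'‖) * ‖ι (y' - y)‖ * ‖ι η‖) := by
  have key := norm_image_sub_le_of_norm_deriv_le_segment_01'
    (f := fun τ : ℝ => sliceDeriv φ₂ (t, y + τ • (y' - y)) η)
    (f' := fun τ => fderiv ℝ (fderiv ℝ fun z => φ₂ (t, z)) (y + τ • (y' - y)) (y' - y) η)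
    (C := κ * (‖ι (y' - y)‖ * ‖η‖ + ‖y' - y‖ * ‖ι η‖
        + (‖y‖ + ‖y'‖) * ‖ι (y' - y)‖ * ‖ι η‖))
    (fun τ hτ => by
      have h1 := hasFDerivAt_sliceDeriv hO hφ₂ (h _ (segment_mem_ball hy hy' hτ)).1
      have h2 := h1.comp_hasDerivAt τ (hasDerivAt_segment y y' τ)
      exact (h2.clm_apply (hasDerivAt_const τ η)).hasDerivWithinAt.congr_deriv (by simp))
    (fun τ hτ => by
      have hτ' := Ico_subset_Icc_self hτ
      refine ((h _ (segment_mem_ball hy hy' hτ')).2 _ _).trans ?_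
      gcongr
      exact norm_segment_le y y' hτ')
  simpa using key

theorem IsTameOnBall.norm_sub_sub_le (hO : IsOpen O)
    (hφ₂ : ContDiffOn ℝ 2 φ₂ {p | (p.1, ι p.2) ∈ O}) {t : ℝ} {c : H₁} {δ κ : ℝ} (hκ : 0 ≤ κ)
    (h : IsTameOnBall ι O φ₂ t c δ κ) {y y' : H₂} (hy : dist (ι y) c < δ)
    (hy' : dist (ι y') c < δ) :
    ‖φ₂ (t, y') - φ₂ (t, y) - sliceDeriv φ₂ (t, y) (y' - y)‖ ≤
      κ * (2 * (‖ι (y' - y)‖ * ‖y' - y‖)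
        + 2 * ((‖y‖ + ‖y'‖) * (‖ι (y' - y)‖ * ‖ι (y' - y)‖))) := by
  have key := norm_image_sub_le_of_norm_deriv_le_segment_01'
    -- Subtracting the linear part turns the derivative in τ into a difference of slice derivatives,
    -- to which the previous estimate applies with η = y' - y.
    (f := fun τ : ℝ => φ₂ (t, y + τ • (y' - y)) - τ • sliceDeriv φ₂ (t, y) (y' - y))
    (f' := fun τ => sliceDeriv φ₂ (t, y + τ • (y' - y)) (y' - y)
      - sliceDeriv φ₂ (t, y) (y' - y))
    (C := κ * (2 * (‖ι (y' - y)‖ * ‖y' - y‖)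
        + 2 * ((‖y‖ + ‖y'‖) * (‖ι (y' - y)‖ * ‖ι (y' - y)‖))))
    (fun τ hτ => by
      have h1 := hasFDerivAt_restriction hO hφ₂ (h _ (segment_mem_ball hy hy' hτ)).1
      have h2 := h1.comp_hasDerivAt τ (hasDerivAt_segment y y' τ)
      have h3 := (hasDerivAt_id τ).smul_const (sliceDeriv φ₂ (t, y) (y' - y))
      exact (h2.sub h3).hasDerivWithinAt.congr_deriv (by simp))
    (fun τ hτ => by
      have hτ' := Ico_subset_Icc_self hτ
      refine (h.norm_sliceDeriv_sub_le hO hφ₂ hκ hy (segment_mem_ball hy hy' hτ') _).trans ?_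
      have e : y + τ • (y' - y) - y = τ • (y' - y) := by abel
      have hτ1 : ‖τ‖ ≤ 1 := by
        rw [Real.norm_of_nonneg hτ'.1]; exact hτ'.2
      have e1 : ‖ι (τ • (y' - y))‖ ≤ ‖ι (y' - y)‖ := by
        rw [map_smul, norm_smul]
        exact mul_le_of_le_one_left (norm_nonneg _) hτ1
      have e2 : ‖τ • (y' - y)‖ ≤ ‖y' - y‖ := by
        rw [norm_smul]
        exact mul_le_of_le_one_left (norm_nonneg _) hτ1
      rw [e]
      have e3 : ‖y‖ + ‖y + τ • (y' - y)‖ ≤ 2 * (‖y‖ + ‖y'‖) := by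
        linarith [norm_segment_le y y' hτ', norm_nonneg y, norm_nonneg y']
      calc _ ≤ κ * (‖ι (y' - y)‖ * ‖y' - y‖ + ‖y' - y‖ * ‖ι (y' - y)‖
            + (2 * (‖y‖ + ‖y'‖)) * ‖ι (y' - y)‖ * ‖ι (y' - y)‖) := by gcongr
        _ = _ := by ring)
  simp only [one_smul, zero_smul, add_zero, sub_zero, add_sub_cancel] at key
  rwa [sub_right_comm] at key

/-- The tame estimate and the linear growth it implies, uniformly along a compact set. -/
theorem exists_uniform_tame_growth (hι_dense : DenseRange ι) (hι_norm : ∀ y, ‖ι y‖ ≤ ‖y‖)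
    (hO : IsOpen O)
    (hφ₂ : ContDiffOn ℝ 2 φ₂ {p | (p.1, ι p.2) ∈ O})
    (htame : ∀ p ∈ O, ∃ W : Set (ℝ × H₁), IsOpen W ∧ p ∈ W ∧ W ⊆ O ∧ ∃ κ : ℝ, 0 < κ ∧
      ∀ t y, (t, ι y) ∈ W → ∀ ξ η : H₂,
        ‖fderiv ℝ (fderiv ℝ fun z => φ₂ (t, z)) y ξ η‖ ≤
          κ * (‖ι ξ‖ * ‖η‖ + ‖ξ‖ * ‖ι η‖ + ‖y‖ * ‖ι ξ‖ * ‖ι η‖))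
    {K : Set (ℝ × H₁)} (hK : IsCompact K) (hKO : K ⊆ O) :
    ∃ δ > 0, ∃ C ≥ 0, ∀ t c, (t, c) ∈ K → IsTameOnBall ι O φ₂ t c δ C ∧
      ∀ y, dist (ι y) c < δ → ‖φ₂ (t, y)‖ ≤ C * (1 + ‖y‖) ∧
        ∀ η, ‖sliceDeriv φ₂ (t, y) η‖ ≤ C * (‖η‖ + ‖y‖ * ‖ι η‖) := by
  have hopen := isOpen_restrictDomain (ι := ι) hO
  refine hK.induction_on (p := fun S => ∃ δ > 0, ∃ C ≥ 0, ∀ t c, (t, c) ∈ S →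
    IsTameOnBall ι O φ₂ t c δ C ∧
      ∀ y, dist (ι y) c < δ → ‖φ₂ (t, y)‖ ≤ C * (1 + ‖y‖) ∧
        ∀ η, ‖sliceDeriv φ₂ (t, y) η‖ ≤ C * (‖η‖ + ‖y‖ * ‖ι η‖)) ?_ ?_ ?_ ?_
  · exact ⟨1, one_pos, 0, le_rfl, fun _ _ h => h.elim⟩
  · rintro S S' hSS ⟨δ, hδ, C, hC, h⟩
    exact ⟨δ, hδ, C, hC, fun t c hm => h t c (hSS hm)⟩
  · have aux : ∀ {t c} {δ δ' C C' : ℝ}, δ' ≤ δ → C ≤ C' → (IsTameOnBall ι O φ₂ t c δ C ∧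
      ∀ y, dist (ι y) c < δ → ‖φ₂ (t, y)‖ ≤ C * (1 + ‖y‖) ∧
        ∀ η, ‖sliceDeriv φ₂ (t, y) η‖ ≤ C * (‖η‖ + ‖y‖ * ‖ι η‖)) →
      (IsTameOnBall ι O φ₂ t c δ' C' ∧
      ∀ y, dist (ι y) c < δ' → ‖φ₂ (t, y)‖ ≤ C' * (1 + ‖y‖) ∧
        ∀ η, ‖sliceDeriv φ₂ (t, y) η‖ ≤ C' * (‖η‖ + ‖y‖ * ‖ι η‖)) := by
      intro t c δ δ' C C' hδ hC h
      refine ⟨h.1.mono (by simpa using hδ) hC, fun y hy => ?_⟩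
      obtain ⟨h1, h2⟩ := h.2 y (hy.trans_le hδ)
      exact ⟨h1.trans (by gcongr), fun η => (h2 η).trans (by gcongr)⟩
    rintro S S' ⟨δ, hδ, C, hC, h⟩ ⟨δ', hδ', C', hC', h'⟩
    refine ⟨min δ δ', lt_min hδ hδ', max C C', hC.trans (le_max_left _ _), ?_⟩
    rintro t c (hm | hm)
    · exact aux (min_le_left _ _) (le_max_left _ _) (h t c hm)
    · exact aux (min_le_right _ _) (le_max_right _ _) (h' t c hm)
  · rintro ⟨t₀, c₀⟩ hp
    obtain ⟨W, hW, hpW, hWO, κ, hκ, hest⟩ := htame _ (hKO hp)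
    obtain ⟨r₀, hr₀, hball⟩ := Metric.isOpen_iff.1 hW _ hpW
    set r := min r₀ (1 / 2) with hr
    have hrpos : 0 < r := lt_min hr₀ (by norm_num)
    have hrh : r ≤ 1 / 2 := min_le_right _ _
    -- The centre c₀ need not lie in H₂, so the expansions below start from a nearby point y₀ of H₂,
    -- provided by density. The bound r ≤ 1/2 keeps ‖ι (y - y₀)‖ ≤ 1.
    obtain ⟨y₀, hy₀⟩ := hι_dense.exists_dist_lt c₀ hrpos
    rw [dist_comm] at hy₀
    have htball : ∀ t, dist t t₀ < r → IsTameOnBall ι O φ₂ t c₀ r κ := fun t ht y hy => by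
      have : (t, ι y) ∈ W := hball (by
        rw [Metric.mem_ball, Prod.dist_eq]
        exact (max_lt ht hy).trans_le (min_le_left _ _))
      exact ⟨hWO this, hest t y this⟩
    have hmem : (t₀, y₀) ∈ {p : ℝ × H₂ | (p.1, ι p.2) ∈ O} :=
      (htball t₀ (by simpa using hrpos) y₀ hy₀).1
    have hslice : Continuous fun t : ℝ => (t, y₀) := by fun_prop
    have c1 : ContinuousAt (fun t => ‖φ₂ (t, y₀)‖) t₀ :=
      (ContinuousAt.comp (f := fun t : ℝ => (t, y₀))
        (hφ₂.continuousOn.continuousAt (hopen.mem_nhds hmem)) hslice.continuousAt).norm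
    have c2 : ContinuousAt (fun t => ‖sliceDeriv φ₂ (t, y₀)‖) t₀ :=
      (ContinuousAt.comp (f := fun t : ℝ => (t, y₀))
        (((hφ₂.of_le one_le_two).continuousOn_sliceDeriv hopen).continuousAt
          (hopen.mem_nhds hmem)) hslice.continuousAt).norm
    set B := ‖φ₂ (t₀, y₀)‖ + ‖sliceDeriv φ₂ (t₀, y₀)‖ + 1 with hB
    have hev : ∀ᶠ t in 𝓝 t₀, ‖φ₂ (t, y₀)‖ < B ∧ ‖sliceDeriv φ₂ (t, y₀)‖ < B := by
      refine (c1.eventually_lt_const ?_).and (c2.eventually_lt_const ?_)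
      · linarith [norm_nonneg (sliceDeriv φ₂ (t₀, y₀))]
      · linarith [norm_nonneg (φ₂ (t₀, y₀))]
    obtain ⟨ρ, hρ, hρB⟩ := Metric.eventually_nhds_iff.1 hev
    have hB0 : 0 ≤ B := by positivity
    -- Here B bounds φ₂ and its slice derivative at y₀ for times near t₀. Taylor expansion at y₀
    -- contributes at most B + (B + 4κ)(‖y‖ + ‖y₀‖), which this C absorbs into C(1 + ‖y‖); it also
    -- covers the slice derivative.
    set C := (B + 4 * κ) * (1 + ‖y₀‖) with hC
    have hκy : 0 ≤ κ * ‖y₀‖ := by positivity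
    have hBy : 0 ≤ B * ‖y₀‖ := by positivity
    have hC1 : B + 4 * κ ≤ C := by rw [hC]; nlinarith
    refine ⟨K ∩ Metric.ball (t₀, c₀) (min (r / 2) ρ),
      inter_mem_nhdsWithin K (Metric.ball_mem_nhds _ (by positivity)), r / 2, by positivity, C,
      by positivity, ?_⟩
    rintro t c ⟨-, hm⟩
    rw [Metric.mem_ball, Prod.dist_eq, max_lt_iff] at hm
    have ht : dist t t₀ < r / 2 := hm.1.trans_le (min_le_left _ _)
    have hc : dist c c₀ < r / 2 := hm.2.trans_le (min_le_left _ _)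
    obtain ⟨hB1, hB2⟩ := hρB (hm.1.trans_le (min_le_right _ _))
    have htb := htball t (by linarith)
    refine ⟨htb.mono (by linarith) (by linarith), fun y hy => ?_⟩
    have hy' : dist (ι y) c₀ < r := by linarith [dist_triangle (ι y) c c₀]
    have hd1 : ‖ι (y - y₀)‖ ≤ 1 := by
      rw [map_sub, ← dist_eq_norm]
      linarith [dist_triangle_right (ι y) (ι y₀) c₀]
    have hd2 : ‖y - y₀‖ ≤ ‖y‖ + ‖y₀‖ := norm_sub_le _ _
    constructor
    · have h1 := htb.norm_sub_sub_le hO hφ₂ hκ.le hy₀ hy'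
      have h2 : ‖sliceDeriv φ₂ (t, y₀) (y - y₀)‖ ≤ B * (‖y‖ + ‖y₀‖) :=
        ((sliceDeriv φ₂ (t, y₀)).le_opNorm _).trans (by gcongr)
      have h3 : κ * (2 * (‖ι (y - y₀)‖ * ‖y - y₀‖)
          + 2 * ((‖y₀‖ + ‖y‖) * (‖ι (y - y₀)‖ * ‖ι (y - y₀)‖)))
          ≤ κ * (2 * (1 * (‖y‖ + ‖y₀‖)) + 2 * ((‖y₀‖ + ‖y‖) * (1 * 1))) := by
        gcongr
      have h4 : φ₂ (t, y) = (φ₂ (t, y) - φ₂ (t, y₀) - sliceDeriv φ₂ (t, y₀) (y - y₀))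
          + φ₂ (t, y₀) + sliceDeriv φ₂ (t, y₀) (y - y₀) := by abel
      rw [h4]
      refine (norm_add₃_le ).trans ?_
      have h5 : (B + 4 * κ) * ‖y‖ ≤ C * ‖y‖ := by gcongr
      have h6 : C = B + 4 * κ + B * ‖y₀‖ + 4 * (κ * ‖y₀‖) := by rw [hC]; ring
      linarith [h1.trans h3]
    · intro η
      have h1 := htb.norm_sliceDeriv_sub_le hO hφ₂ hκ.le hy₀ hy' η
      have h2 : ‖sliceDeriv φ₂ (t, y₀) η‖ ≤ B * ‖η‖ :=
        ((sliceDeriv φ₂ (t, y₀)).le_opNorm _).trans (by gcongr)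
      have h3 : κ * (‖ι (y - y₀)‖ * ‖η‖ + ‖y - y₀‖ * ‖ι η‖
          + (‖y₀‖ + ‖y‖) * ‖ι (y - y₀)‖ * ‖ι η‖)
          ≤ κ * (1 * ‖η‖ + (‖y‖ + ‖y₀‖) * ‖ι η‖ + (‖y₀‖ + ‖y‖) * 1 * ‖ι η‖) := by
        gcongr
      have h4 : ‖sliceDeriv φ₂ (t, y) η‖ ≤ ‖sliceDeriv φ₂ (t, y) η - sliceDeriv φ₂ (t, y₀) η‖
          + ‖sliceDeriv φ₂ (t, y₀) η‖ := by
        simpa using norm_add_le (sliceDeriv φ₂ (t, y) η - sliceDeriv φ₂ (t, y₀) η)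
          (sliceDeriv φ₂ (t, y₀) η)
      have h5 : κ * ‖y₀‖ * ‖ι η‖ ≤ κ * ‖y₀‖ * ‖η‖ := by gcongr; exact hι_norm η
      have h6 : (B + κ + 2 * (κ * ‖y₀‖)) * ‖η‖ ≤ C * ‖η‖ := by
        gcongr
        have : C = B + 4 * κ + B * ‖y₀‖ + 4 * (κ * ‖y₀‖) := by rw [hC]; ring
        linarith
      have h7 : 2 * κ * (‖y‖ * ‖ι η‖) ≤ C * (‖y‖ * ‖ι η‖) := by
        gcongr; linarith
      linarith [h1.trans h3]

end Tame

/-! ### The superposition operator into L²(ℝ, H₂) -/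

section Superposition

theorem norm_toLp_norm {F : Type*} [NormedAddCommGroup F] (g : L2R F) :
    ‖(Lp.memLp g).norm.toLp‖ = ‖g‖ := by
  rw [Lp.norm_toLp, eLpNorm_norm, ← Lp.norm_def]

theorem L2R_norm_le_of_ae_le {E F₁ F₂ F₃ : Type*} [NormedAddCommGroup E]
    [NormedAddCommGroup F₁] [NormedAddCommGroup F₂] [NormedAddCommGroup F₃]
    {f : L2R E} {g₁ : L2R F₁} {g₂ : L2R F₂} {g₃ : L2R F₃} {a b c : ℝ}
    (ha : 0 ≤ a) (hb : 0 ≤ b) (hc : 0 ≤ c)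
    (h : ∀ᵐ s, ‖f s‖ ≤ a * ‖g₁ s‖ + b * ‖g₂ s‖ + c * ‖g₃ s‖) :
    ‖f‖ ≤ a * ‖g₁‖ + b * ‖g₂‖ + c * ‖g₃‖ := by
  set n₁ : L2R ℝ := (Lp.memLp g₁).norm.toLp
  set n₂ : L2R ℝ := (Lp.memLp g₂).norm.toLp
  set n₃ : L2R ℝ := (Lp.memLp g₃).norm.toLp
  have h1 : ‖f‖ ≤ ‖a • n₁ + b • n₂ + c • n₃‖ := by
    refine Lp.norm_le_norm_of_ae_le ?_
    filter_upwards [h, Lp.coeFn_add (a • n₁ + b • n₂) (c • n₃), Lp.coeFn_add (a • n₁) (b • n₂),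
      Lp.coeFn_smul a n₁, Lp.coeFn_smul b n₂, Lp.coeFn_smul c n₃,
      (Lp.memLp g₁).norm.coeFn_toLp, (Lp.memLp g₂).norm.coeFn_toLp,
      (Lp.memLp g₃).norm.coeFn_toLp] with s h h1 h2 h3 h4 h5 h6 h7 h8
    rw [h1, Pi.add_apply, h2, Pi.add_apply, h3, h4, h5, Pi.smul_apply, Pi.smul_apply,
      Pi.smul_apply, h6, h7, h8]
    exact h.trans (Real.le_norm_self _)
  refine h1.trans ((norm_add₃_le).trans (le_of_eq ?_))
  rw [norm_smul, norm_smul, norm_smul, Real.norm_of_nonneg ha, Real.norm_of_nonneg hb,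
    Real.norm_of_nonneg hc, norm_toLp_norm, norm_toLp_norm, norm_toLp_norm]

/-- Extended by zero off the open set, f is Borel; separability of the target upgrades measurability
to strong measurability. -/
theorem aestronglyMeasurable_comp_of_continuousOn {Z E : Type*} [TopologicalSpace Z]
    [TopologicalSpace.PseudoMetrizableSpace Z] [NormedAddCommGroup E]
    [SecondCountableTopology E] {f : Z → E} {S : Set Z} (hS : IsOpen S) (hf : ContinuousOn f S)
    {g : ℝ → Z} (hg : AEStronglyMeasurable g volume) (hgS : ∀ᵐ s, g s ∈ S) :
    AEStronglyMeasurable (fun s => f (g s)) volume := by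
  classical
  borelize Z E
  have hm : Measurable (S.piecewise f 0) :=
    hf.measurable_piecewise continuous_zero.continuousOn hS.measurableSet
  refine (hm.comp_aemeasurable hg.aemeasurable).aestronglyMeasurable.congr ?_
  filter_upwards [hgS] with s hs
  simp [hs]

variable {H₁ H₂ : Type*} [NormedAddCommGroup H₁] [InnerProductSpace ℝ H₁]
  [NormedAddCommGroup H₂] [InnerProductSpace ℝ H₂] {ι : H₂ →L[ℝ] H₁}
  {T : ℝ} {O : Set (ℝ × H₁)} {φ₂ : ℝ × H₂ → H₂}

theorem norm_pathSpace_fst_le (ξ : pathSpace ι) : ‖ξ.1.fst‖ ≤ ‖ξ‖ := by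
  have hn : ‖ξ‖ ^ 2 = ‖ξ.1.fst‖ ^ 2 + ‖ξ.1.snd‖ ^ 2 := WithLp.prod_norm_sq_eq_of_L2 ξ.1
  refine le_of_sq_le_sq ?_ (norm_nonneg _)
  nlinarith [sq_nonneg ‖ξ.1.snd‖]

theorem coeFn_fst_add (ξ η : pathSpace ι) :
    ((ξ + η).1.fst : ℝ → H₂) =ᵐ[volume] fun s => ξ.1.fst s + η.1.fst s :=
  Lp.coeFn_add ξ.1.fst η.1.fst

theorem coeFn_fst_sub (ξ η : pathSpace ι) :
    ((ξ - η).1.fst : ℝ → H₂) =ᵐ[volume] fun s => ξ.1.fst s - η.1.fst s :=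
  Lp.coeFn_sub ξ.1.fst η.1.fst

theorem coeFn_fst_smul (c : ℝ) (ξ : pathSpace ι) :
    ((c • ξ).1.fst : ℝ → H₂) =ᵐ[volume] fun s => c • ξ.1.fst s :=
  Lp.coeFn_smul c ξ.1.fst

/-- The restriction `φ₂` to `H₂` of a parametrized tame, asymptotically constant map. -/
structure IsTameRestriction (ι : H₂ →L[ℝ] H₁) (T : ℝ) (O : Set (ℝ × H₁)) (φ₂ : ℝ × H₂ → H₂) :
    Prop where
  dense : DenseRange ι
  norm_le : ∀ y, ‖ι y‖ ≤ ‖y‖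
  domain : IsEndConstantDomain T O
  contDiffOn : ContDiffOn ℝ 2 φ₂ {p | (p.1, ι p.2) ∈ O}
  tame : ∀ p ∈ O, ∃ W : Set (ℝ × H₁), IsOpen W ∧ p ∈ W ∧ W ⊆ O ∧ ∃ κ : ℝ, 0 < κ ∧
      ∀ t y, (t, ι y) ∈ W → ∀ ξ η : H₂,
        ‖fderiv ℝ (fderiv ℝ fun z => φ₂ (t, z)) y ξ η‖ ≤
          κ * (‖ι ξ‖ * ‖η‖ + ‖ξ‖ * ‖ι η‖ + ‖y‖ * ‖ι ξ‖ * ‖ι η‖)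
  zero : ∀ s, T ≤ |s| → φ₂ (s, 0) = 0

/-- The bound C(1 + ‖y‖) is not square integrable in s. On the ends the constant disappears by
expanding about 0, where φ₂ vanishes, so it survives only on a bounded interval. -/
theorem IsTameRestriction.exists_growth (h : IsTameRestriction ι T O φ₂) {u : C₀(ℝ, H₁)}
    (hu : u ∈ graphDomain O) :
    ∃ δ > 0, ∃ C ≥ 0, ∃ S : ℝ, ∀ s, IsTameOnBall ι O φ₂ (clamp T s) (u s) δ C ∧
      ∀ y, dist (ι y) (u s) < δ →
        ‖φ₂ (clamp T s, y)‖ ≤ C * (‖y‖ + (Icc (-S) S).indicator 1 s) ∧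
        ∀ η, ‖sliceDeriv φ₂ (clamp T s, y) η‖ ≤ C * (‖η‖ + ‖y‖ * ‖ι η‖) := by
  obtain ⟨K, hK, hKO, hKu⟩ := h.domain.exists_isCompact hu
  obtain ⟨δ, hδ, C, hC, hg⟩ := exists_uniform_tame_growth h.dense h.norm_le h.domain.isOpen
    h.contDiffOn h.tame hK hKO
  set δ' := min δ (1 / 2) with hδ'
  have hδ'0 : 0 < δ' := lt_min hδ (by norm_num)
  have hδ'δ : δ' ≤ δ := min_le_left _ _
  have hδ'1 : δ' ≤ 1 / 2 := min_le_right _ _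
  have hev : ∀ᶠ s in cocompact ℝ, dist (u s) 0 < δ' :=
    (Metric.tendsto_nhds.1 (zero_at_infty u)) δ' hδ'0
  obtain ⟨R, hR⟩ : ∃ R : ℝ, ∀ s, R < |s| → dist (u s) 0 < δ' := by
    rw [← Metric.cobounded_eq_cocompact, (Metric.hasBasis_cobounded_compl_closedBall
      (0 : ℝ)).eventually_iff] at hev
    obtain ⟨R, -, hR⟩ := hev
    exact ⟨R, fun s hs => hR (by simpa using hs)⟩
  -- The factor 5 is 4 from the Taylor remainder at 0, where ‖ι y‖ ≤ 1, plus 1 from the linear term.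
  -- Beyond max R T the curve is H₁-close to 0 and φ₂ vanishes at 0.
  refine ⟨δ', hδ'0, 5 * C, by positivity, max R T, fun s => ?_⟩
  obtain ⟨h1, h2⟩ := hg _ _ (hKu s)
  refine ⟨h1.mono (by simpa using hδ'δ) (by linarith), fun y hy => ?_⟩
  have hyδ := hy.trans_le hδ'δ
  refine ⟨?_, fun η => ((h2 y hyδ).2 η).trans (by gcongr; linarith)⟩
  by_cases hs : s ∈ Icc (-(max R T)) (max R T)
  · rw [indicator_of_mem hs, Pi.one_apply, add_comm]
    exact ((h2 y hyδ).1).trans (by gcongr; linarith)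
  · rw [indicator_of_notMem hs, add_zero]
    rw [mem_Icc, ← abs_le, not_le] at hs
    have hus := hR s ((le_max_left _ _).trans_lt hs)
    have h0 : dist (ι 0) (u s) < δ := by
      rw [map_zero, dist_comm]; exact hus.trans_le hδ'δ
    have h3 := h1.norm_sub_sub_le h.domain.isOpen h.contDiffOn hC h0 hyδ
    rw [h.zero _ (le_abs_clamp h.domain.pos ((le_max_right _ _).trans hs.le))] at h3
    have h4 := (h2 0 h0).2 y
    have h5 : ‖ι y‖ ≤ 1 := by
      rw [← dist_zero_right]
      linarith [dist_triangle (ι y) (u s) 0]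
    simp only [sub_zero, norm_zero, zero_add, zero_mul, add_zero] at h3 h4
    have h6 : C * (2 * (‖ι y‖ * ‖y‖) + 2 * (‖y‖ * (‖ι y‖ * ‖ι y‖)))
        ≤ C * (2 * (1 * ‖y‖) + 2 * (‖y‖ * (1 * 1))) := by gcongr
    have h7 : ‖φ₂ (clamp T s, y)‖ ≤
        ‖φ₂ (clamp T s, y) - sliceDeriv φ₂ (clamp T s, 0) y‖
          + ‖sliceDeriv φ₂ (clamp T s, 0) y‖ := by
      simpa using norm_add_le (φ₂ (clamp T s, y) - sliceDeriv φ₂ (clamp T s, 0) y)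
        (sliceDeriv φ₂ (clamp T s, 0) y)
    linarith [h3.trans h6]

variable [CompleteSpace H₁]

theorem ae_mem_restrictDomain (hO : IsEndConstantDomain T O) {ξ : pathSpace ι}
    (hξ : ξ ∈ pathDomain ι O) : ∀ᵐ s, (clamp T s, ι (ξ.1.fst s)) ∈ O := by
  rw [pathDomain_eq_preimage] at hξ
  filter_upwards [pathRep_ae_eq ι ξ] with s hs
  rw [← hs]
  exact (hO.mem_iff _ _).1 (hξ s)

theorem ae_norm_le (η : pathSpace ι) : ∀ᵐ s, ‖ι (η.1.fst s)‖ ≤ (1 + ‖ι‖) * ‖η‖ := by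
  filter_upwards [pathRep_ae_eq ι η] with s hs
  rw [← hs]
  exact norm_pathRep_apply_le η s

theorem isOpen_pathDomain (hO : IsEndConstantDomain T O) : IsOpen (pathDomain ι O) := by
  rw [pathDomain_eq_preimage]
  exact hO.isOpen_graphDomain.preimage (pathRep ι).continuous

theorem ae_dist_lt {ξ ζ : pathSpace ι} {δ : ℝ} (h : (1 + ‖ι‖) * ‖ζ - ξ‖ < δ) :
    ∀ᵐ s, dist (ι (ζ.1.fst s)) (pathRep ι ξ s) < δ := by
  filter_upwards [pathRep_ae_eq ι ξ, coeFn_fst_sub ζ ξ, ae_norm_le (ζ - ξ)] with s h1 h2 h3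
  rw [h1, dist_eq_norm, ← map_sub, ← h2]
  exact h3.trans_lt h

open Classical in
/-- The superposition operator `ξ ↦ [s ↦ φ₂(s, ξ_s)]` with values in `L²(ℝ, H₂)`. -/
noncomputable def superposition (T : ℝ) (φ₂ : ℝ × H₂ → H₂) (ξ : pathSpace ι) : L2R H₂ :=
  if h : MemLp (fun s => φ₂ (clamp T s, ξ.1.fst s)) 2 volume then h.toLp else 0

variable [SecondCountableTopology H₂]

theorem coeFn_superposition (h : IsTameRestriction ι T O φ₂) {ξ : pathSpace ι}
    (hξ : ξ ∈ pathDomain ι O) :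
    superposition T φ₂ ξ =ᵐ[volume] fun s => φ₂ (clamp T s, ξ.1.fst s) := by
  have hmem : MemLp (fun s => φ₂ (clamp T s, ξ.1.fst s)) 2 volume := by
    have hmeas := aestronglyMeasurable_comp_of_continuousOn
      (isOpen_restrictDomain (ι := ι) h.domain.isOpen) h.contDiffOn.continuousOn
      ((continuous_clamp T).aestronglyMeasurable.prodMk (Lp.aestronglyMeasurable ξ.1.fst))
      (ae_mem_restrictDomain h.domain hξ)
    rw [pathDomain_eq_preimage] at hξ
    obtain ⟨δ, hδ, C, hC, S, hg⟩ := h.exists_growth hξ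
    have hind : MemLp ((Icc (-S) S).indicator (1 : ℝ → ℝ)) 2 volume :=
      memLp_indicator_const 2 measurableSet_Icc 1 (Or.inr (by simp))
    refine (((Lp.memLp ξ.1.fst).norm.add hind).const_mul C).mono' hmeas ?_
    filter_upwards [pathRep_ae_eq ι ξ] with s hs
    exact ((hg s).2 _ (by rw [← hs, dist_self]; exact hδ)).1
  rw [superposition, dif_pos hmem]
  exact hmem.coeFn_toLp

/-- In the bound ‖η‖ + ‖ξ‖ ‖ι η‖ the factor ‖ι η‖ is bounded uniformly in s by Sobolev, so both
summands are square integrable. -/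
theorem exists_superpositionDeriv (h : IsTameRestriction ι T O φ₂) {ξ : pathSpace ι}
    (hξ : ξ ∈ pathDomain ι O) : ∃ A : pathSpace ι →L[ℝ] L2R H₂, ∀ η,
      A η =ᵐ[volume] fun s => sliceDeriv φ₂ (clamp T s, ξ.1.fst s) (η.1.fst s) := by
  have hξ' := hξ
  rw [pathDomain_eq_preimage] at hξ'
  obtain ⟨δ, hδ, C, hC, S, hg⟩ := h.exists_growth hξ'
  have hopen := isOpen_restrictDomain (ι := ι) h.domain.isOpen
  have hb : ∀ η : pathSpace ι, ∀ᵐ s,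
      ‖sliceDeriv φ₂ (clamp T s, ξ.1.fst s) (η.1.fst s)‖
        ≤ C * ‖η.1.fst s‖ + (C * ((1 + ‖ι‖) * ‖η‖)) * ‖ξ.1.fst s‖ := fun η => by
    filter_upwards [pathRep_ae_eq ι ξ, ae_norm_le η] with s hs hη
    refine (((hg s).2 _ (by rw [← hs, dist_self]; exact hδ)).2 _).trans ?_
    calc C * (‖η.1.fst s‖ + ‖ξ.1.fst s‖ * ‖ι (η.1.fst s)‖)
        ≤ C * (‖η.1.fst s‖ + ‖ξ.1.fst s‖ * ((1 + ‖ι‖) * ‖η‖)) := by gcongr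
      _ = _ := by ring
  have hmem : ∀ η : pathSpace ι,
      MemLp (fun s => sliceDeriv φ₂ (clamp T s, ξ.1.fst s) (η.1.fst s)) 2 volume := fun η => by
    -- Measurability is checked for the joint evaluation, with values in the separable space H₂,
    -- because the space of operators need not be separable.
    have hc : ContinuousOn (fun q : (ℝ × H₂) × H₂ => sliceDeriv φ₂ q.1 q.2)
        (Prod.fst ⁻¹' {p : ℝ × H₂ | (p.1, ι p.2) ∈ O}) :=
      (((h.contDiffOn.of_le one_le_two).continuousOn_sliceDeriv hopen).comp
        continuousOn_fst (fun _ hq => hq)).clm_apply continuousOn_snd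
    have hmeas := aestronglyMeasurable_comp_of_continuousOn (hopen.preimage continuous_fst) hc
      (((continuous_clamp T).aestronglyMeasurable.prodMk
        (Lp.aestronglyMeasurable ξ.1.fst)).prodMk (Lp.aestronglyMeasurable η.1.fst))
      (ae_mem_restrictDomain h.domain hξ)
    exact (((Lp.memLp η.1.fst).norm.const_mul C).add
      ((Lp.memLp ξ.1.fst).norm.const_mul _)).mono' hmeas (hb η)
  refine ⟨LinearMap.mkContinuous
    { toFun := fun η => (hmem η).toLp
      map_add' := fun η θ => by
        rw [← MemLp.toLp_add]
        refine MemLp.toLp_congr _ _ ?_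
        filter_upwards [coeFn_fst_add η θ] with s hs
        rw [hs, map_add, Pi.add_apply]
      map_smul' := fun c η => by
        rw [RingHom.id_apply, ← MemLp.toLp_const_smul]
        refine MemLp.toLp_congr _ _ ?_
        filter_upwards [coeFn_fst_smul c η] with s hs
        rw [hs, map_smul, Pi.smul_apply] }
    (C + C * (1 + ‖ι‖) * ‖ξ‖) (fun η => ?_), fun η => (hmem η).coeFn_toLp⟩
  have h1 := L2R_norm_le_of_ae_le (f := (hmem η).toLp) (g₁ := η.1.fst) (g₂ := ξ.1.fst)
    (g₃ := ξ.1.fst) (a := C) (b := C * ((1 + ‖ι‖) * ‖η‖)) (c := 0) hC (by positivity) le_rfl (by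
      filter_upwards [hb η, (hmem η).coeFn_toLp] with s h1 h2
      rw [h2, zero_mul, add_zero]
      exact h1)
  refine h1.trans ?_
  calc C * ‖η.1.fst‖ + C * ((1 + ‖ι‖) * ‖η‖) * ‖ξ.1.fst‖ + 0 * ‖ξ.1.fst‖
      ≤ C * ‖η‖ + C * ((1 + ‖ι‖) * ‖η‖) * ‖ξ‖ + 0 := by
        rw [zero_mul]
        gcongr
        · exact norm_pathSpace_fst_le η
        · exact norm_pathSpace_fst_le ξ
    _ = _ := by ring

/-- The superposition operator of a tame map is continuously differentiable. -/
theorem contDiffOn_superposition (h : IsTameRestriction ι T O φ₂) :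
    ContDiffOn ℝ 1 (superposition (ι := ι) T φ₂) (pathDomain ι O) := by
  classical
  have hopen := isOpen_pathDomain (ι := ι) h.domain
  have hA : ∀ ξ : pathSpace ι, ∃ A : pathSpace ι →L[ℝ] L2R H₂, ξ ∈ pathDomain ι O → ∀ η,
      A η =ᵐ[volume] fun s => sliceDeriv φ₂ (clamp T s, ξ.1.fst s) (η.1.fst s) := fun ξ => by
    by_cases hξ : ξ ∈ pathDomain ι O
    · obtain ⟨A, hA⟩ := exists_superpositionDeriv h hξ
      exact ⟨A, fun _ => hA⟩
    · exact ⟨0, fun h => (hξ h).elim⟩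
  choose A hA using hA
  set c := 1 + ‖ι‖ with hc
  have hc0 : 0 < c := by positivity
  refine contDiffOn_one_of_hasFDerivAt hopen (f' := A) (fun ξ hξ => ?_) fun ξ hξ => ?_
  · have hξ' := hξ
    rw [pathDomain_eq_preimage] at hξ'
    obtain ⟨δ, hδ, C, hC, S, hg⟩ := h.exists_growth hξ'
    refine HasFDerivAt.of_isLittleO (Asymptotics.IsBigO.trans_isLittleO ?_
      (Asymptotics.isLittleO_pow_sub_sub ξ one_lt_two))
    -- The remainder is quadratic in ‖ζ - ξ‖: with m the sup bound on the H₁ increment, each term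
    -- carries m times an L² norm of ζ - ξ, or m² times that of ξ. A surplus factor m is replaced by
    -- δ.
    refine Asymptotics.IsBigO.of_bound (C * (2 * c + 2 * c * δ) + 4 * C * c ^ 2 * ‖ξ‖) ?_
    filter_upwards [Metric.ball_mem_nhds ξ (div_pos hδ hc0), hopen.mem_nhds hξ] with ζ hζ hζO
    rw [Metric.mem_ball, dist_eq_norm, lt_div_iff₀' hc0] at hζ
    set m := c * ‖ζ - ξ‖ with hm
    have hm0 : 0 ≤ m := by positivity
    have h1 := L2R_norm_le_of_ae_le
      (f := superposition T φ₂ ζ - superposition T φ₂ ξ - A ξ (ζ - ξ))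
      (g₁ := (ζ - ξ).1.fst) (g₂ := ξ.1.fst) (g₃ := ξ.1.fst) (a := C * (2 * m + 2 * m ^ 2))
      (b := 4 * C * m ^ 2) (c := 0) (by positivity) (by positivity) le_rfl (by
        filter_upwards [coeFn_superposition h hξ, coeFn_superposition h hζO, hA ξ hξ (ζ - ξ),
          Lp.coeFn_sub (superposition T φ₂ ζ - superposition T φ₂ ξ) (A ξ (ζ - ξ)),
          Lp.coeFn_sub (superposition T φ₂ ζ) (superposition T φ₂ ξ), pathRep_ae_eq ι ξ,
          ae_dist_lt hζ, coeFn_fst_sub ζ ξ, ae_norm_le (ζ - ξ)]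
          with s e1 e2 e3 e4 e5 e6 e7 e8 e9
        rw [e4, Pi.sub_apply, e5, Pi.sub_apply, e1, e2, e3, zero_mul, add_zero]
        have e10 : ‖ζ.1.fst s‖ ≤ ‖ξ.1.fst s‖ + ‖(ζ - ξ).1.fst s‖ := by
          rw [e8]
          simpa using norm_add_le (ξ.1.fst s) (ζ.1.fst s - ξ.1.fst s)
        have key := (hg s).1.norm_sub_sub_le h.domain.isOpen h.contDiffOn hC
          (y := ξ.1.fst s) (y' := ζ.1.fst s) (by rw [e6, dist_self]; exact hδ) e7
        rw [← e8] at key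
        refine key.trans ?_
        calc _ ≤ C * (2 * (m * ‖(ζ - ξ).1.fst s‖)
              + 2 * ((‖ξ.1.fst s‖ + (‖ξ.1.fst s‖ + ‖(ζ - ξ).1.fst s‖)) * (m * m))) := by
              gcongr
          _ = _ := by ring)
    refine h1.trans ?_
    rw [zero_mul, add_zero, Real.norm_of_nonneg (by positivity)]
    calc _ ≤ C * (2 * m + 2 * m ^ 2) * ‖ζ - ξ‖ + 4 * C * m ^ 2 * ‖ξ‖ := by
          gcongr
          · exact norm_pathSpace_fst_le _
          · exact norm_pathSpace_fst_le _
      _ = C * (2 * m + 2 * (m * m)) * ‖ζ - ξ‖ + 4 * C * m ^ 2 * ‖ξ‖ := by ring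
      _ ≤ C * (2 * m + 2 * (m * δ)) * ‖ζ - ξ‖ + 4 * C * m ^ 2 * ‖ξ‖ := by gcongr
      _ = _ := by rw [hm]; ring
  · have hξ' := hξ
    rw [pathDomain_eq_preimage] at hξ'
    obtain ⟨δ, hδ, C, hC, S, hg⟩ := h.exists_growth hξ'
    -- The difference of derivatives is estimated in operator norm and is at most a constant times
    -- ‖ζ - ξ‖ near ξ.
    suffices ht : Tendsto A (𝓝 ξ) (𝓝 (A ξ)) from ContinuousAt.continuousWithinAt ht
    refine (tendsto_iff_norm_sub_tendsto_zero (E := pathSpace ι →L[ℝ] L2R H₂)).2 ?_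
    have hlim : Tendsto (fun ζ => (C * (2 * c + c * δ) + 2 * C * c ^ 2 * ‖ξ‖) * ‖ζ - ξ‖)
        (𝓝 ξ) (𝓝 0) := by
      have := (tendsto_iff_norm_sub_tendsto_zero.1 (tendsto_id (x := 𝓝 ξ))).const_mul
        (C * (2 * c + c * δ) + 2 * C * c ^ 2 * ‖ξ‖)
      simpa using this
    refine squeeze_zero'
      (Eventually.of_forall fun _ => ContinuousLinearMap.opNorm_nonneg _) ?_ hlim
    filter_upwards [Metric.ball_mem_nhds ξ (div_pos hδ hc0), hopen.mem_nhds hξ] with ζ hζ hζO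
    rw [Metric.mem_ball, dist_eq_norm, lt_div_iff₀' hc0] at hζ
    set m := c * ‖ζ - ξ‖ with hm
    have hm0 : 0 ≤ m := by positivity
    refine ContinuousLinearMap.opNorm_le_bound _ (by positivity) fun η => ?_
    set n := c * ‖η‖ with hn
    have hn0 : 0 ≤ n := by positivity
    rw [sub_apply]
    have h1 := L2R_norm_le_of_ae_le (f := A ζ η - A ξ η)
      (g₁ := η.1.fst) (g₂ := (ζ - ξ).1.fst) (g₃ := ξ.1.fst) (a := C * m)
      (b := C * (n + m * n)) (c := 2 * C * (m * n)) (by positivity) (by positivity)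
      (by positivity) (by
        filter_upwards [hA ξ hξ η, hA ζ hζO η, Lp.coeFn_sub (A ζ η) (A ξ η), pathRep_ae_eq ι ξ,
          ae_dist_lt hζ, coeFn_fst_sub ζ ξ, ae_norm_le (ζ - ξ), ae_norm_le η]
          with s e1 e2 e3 e6 e7 e8 e9 e11
        rw [e3, Pi.sub_apply, e1, e2]
        have e10 : ‖ζ.1.fst s‖ ≤ ‖ξ.1.fst s‖ + ‖(ζ - ξ).1.fst s‖ := by
          rw [e8]
          simpa using norm_add_le (ξ.1.fst s) (ζ.1.fst s - ξ.1.fst s)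
        have key := (hg s).1.norm_sliceDeriv_sub_le h.domain.isOpen h.contDiffOn hC
          (y := ξ.1.fst s) (y' := ζ.1.fst s) (by rw [e6, dist_self]; exact hδ) e7 (η.1.fst s)
        rw [← e8] at key
        refine key.trans ?_
        calc _ ≤ C * (m * ‖η.1.fst s‖ + ‖(ζ - ξ).1.fst s‖ * n
              + (‖ξ.1.fst s‖ + (‖ξ.1.fst s‖ + ‖(ζ - ξ).1.fst s‖)) * m * n) := by
              gcongr
          _ = _ := by ring)
    refine h1.trans ?_
    calc _ ≤ C * m * ‖η‖ + C * (n + m * n) * ‖ζ - ξ‖ + 2 * C * (m * n) * ‖ξ‖ := by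
          gcongr
          · exact norm_pathSpace_fst_le _
          · exact norm_pathSpace_fst_le _
          · exact norm_pathSpace_fst_le _
      _ ≤ C * m * ‖η‖ + C * (n + δ * n) * ‖ζ - ξ‖ + 2 * C * (m * n) * ‖ξ‖ := by gcongr
      _ = _ := by rw [hm, hn]; ring

end Superposition

/-! ### Assembling Φ and the weak tangent map -/

section Main

theorem contDiff_mulL2 (H E : Type*) [NormedAddCommGroup H] [NormedSpace ℝ H]
    [NormedAddCommGroup E] [NormedSpace ℝ E] : ContDiff ℝ 1 (mulL2 H E) := by
  fun_prop

section EndConstant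

variable {H E : Type*} [NormedAddCommGroup H] [NormedSpace ℝ H]
  [NormedAddCommGroup E] [NormedSpace ℝ E] {T : ℝ} {O : Set (ℝ × H)}

/-- The derivative in the direction of `ℝ`, as a function of both variables. -/
noncomputable def timeDeriv (f : ℝ × H → E) (p : ℝ × H) : ℝ →L[ℝ] E :=
  (fderiv ℝ f p).comp (.inl ℝ ℝ H)

theorem fderiv_apply_eq (f : ℝ × H → E) (p : ℝ × H) (τ : ℝ) (x : H) :
    fderiv ℝ f p (τ, x) = timeDeriv f p τ + sliceDeriv f p x := by
  simp [timeDeriv, sliceDeriv, ← map_add]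

theorem ContDiffOn.timeDeriv {f : ℝ × H → E} (hO : IsOpen O) (hf : ContDiffOn ℝ 2 f O) :
    ContDiffOn ℝ 1 (timeDeriv f) O :=
  (hf.fderiv_of_isOpen hO (by norm_num)).clm_comp contDiffOn_const

theorem ContDiffOn.sliceDeriv {f : ℝ × H → E} (hO : IsOpen O) (hf : ContDiffOn ℝ 2 f O) :
    ContDiffOn ℝ 1 (sliceDeriv f) O :=
  (hf.fderiv_of_isOpen hO (by norm_num)).clm_comp contDiffOn_const

theorem timeDeriv_eq_zero {f : ℝ × H → E} {s : ℝ} {x : H} (hf : DifferentiableAt ℝ f (s, x))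
    (h : ∀ᶠ t in 𝓝 s, f (t, x) = f (s, x)) : timeDeriv f (s, x) = 0 := by
  have h1 : HasFDerivAt (fun t => f (t, x)) (timeDeriv f (s, x)) s :=
    hf.hasFDerivAt.comp s (hasFDerivAt_prodMk_left s x)
  exact h1.unique ((hasFDerivAt_const (f (s, x)) s).congr_of_eventuallyEq h)

end EndConstant

section Asymptotic

variable {H : Type*} [NormedAddCommGroup H] {O : Set (ℝ × H)} {φ : ℝ × H → H}

/-- All the asymptotic information on `φ`: outside `(-T, T)` the slices do not depend on `s`,
even locally near `s = ±T`. -/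
theorem IsAsymptoticallyConstant.exists_isEndConstant (hO : IsOpen O)
    (h : IsAsymptoticallyConstant O φ) :
    ∃ T, IsEndConstantDomain T O ∧ IsEndConstant T O φ ∧
      (∀ s, T ≤ |s| → φ (s, 0) = 0) ∧
      ∀ s x, T ≤ |s| → (s, x) ∈ O → ∀ᶠ t in 𝓝 s, φ (t, x) = φ (s, x) := by
  obtain ⟨T, hT, hc, h0⟩ := h
  have key : ∀ s x, ((s, x) ∈ O ↔ (clamp (T + 1) s, x) ∈ O) ∧
      ((s, x) ∈ O → φ (s, x) = φ (clamp (T + 1) s, x)) := fun s x => by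
    rcases le_total |s| (T + 1) with hs | hs
    · rw [clamp_of_abs_le hs]; simp
    · rcases le_abs.1 hs with hs | hs
      · rw [clamp_of_le (by linarith) hs]
        exact hc _ _ (Or.inr ⟨by linarith, by linarith⟩) x
      · rw [clamp_of_le_neg (by linarith) (by linarith)]
        exact hc _ _ (Or.inl ⟨by linarith, by linarith⟩) x
  -- Enlarging T by one makes φ constant in time on a full neighbourhood of the new endpoints, so
  -- that ∂_sφ vanishes there too.
  refine ⟨T + 1, ⟨by linarith, hO, fun s x => (key s x).1, fun s hs => (h0 s (by linarith)).1⟩,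
    fun s x => (key s x).2, fun s hs => (h0 s (by linarith)).2, fun s x hs hx => ?_⟩
  rcases le_abs.1 hs with hs | hs
  · filter_upwards [Ioi_mem_nhds (show T < s by linarith)] with t ht
    exact ((hc s t (Or.inr ⟨by linarith, le_of_lt ht⟩) x).2 hx).symm
  · filter_upwards [Iio_mem_nhds (show s < -T by linarith)] with t ht
    exact ((hc s t (Or.inl ⟨by linarith, le_of_lt ht⟩) x).2 hx).symm

end Asymptotic

variable {H₁ H₂ : Type*} [NormedAddCommGroup H₁] [InnerProductSpace ℝ H₁]
  [NormedAddCommGroup H₂] [InnerProductSpace ℝ H₂] {ι : H₂ →L[ℝ] H₁}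
  {T : ℝ} {O : Set (ℝ × H₁)} {φ : ℝ × H₁ → H₁} {φ₂ : ℝ × H₂ → H₂}

/-- The data of a parametrized tame, asymptotically constant map and its restriction. -/
structure IsTamePair (ι : H₂ →L[ℝ] H₁) (T : ℝ) (O : Set (ℝ × H₁)) (φ : ℝ × H₁ → H₁)
    (φ₂ : ℝ × H₂ → H₂) : Prop where
  contDiffOn : ContDiffOn ℝ 2 φ O
  endConstant : IsEndConstant T O φ
  eventually_eq : ∀ s x, T ≤ |s| → (s, x) ∈ O → ∀ᶠ t in 𝓝 s, φ (t, x) = φ (s, x)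
  restriction : IsTameRestriction ι T O φ₂
  map_restriction : ∀ t y, (t, ι y) ∈ O → ι (φ₂ (t, y)) = φ (t, ι y)

namespace IsTamePair

theorem differentiableAt (h : IsTamePair ι T O φ φ₂) {p : ℝ × H₁} (hp : p ∈ O) :
    DifferentiableAt ℝ φ p :=
  (h.contDiffOn.differentiableOn two_ne_zero).differentiableAt
    (h.restriction.domain.isOpen.mem_nhds hp)

theorem timeDeriv_eq_zero (h : IsTamePair ι T O φ φ₂) {s : ℝ} {x : H₁} (hs : T ≤ |s|)
    (hx : (s, x) ∈ O) : timeDeriv φ (s, x) = 0 :=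
  _root_.timeDeriv_eq_zero (h.differentiableAt hx) (h.eventually_eq s x hs hx)

theorem timeDeriv_isEndConstant (h : IsTamePair ι T O φ φ₂) :
    IsEndConstant T O (timeDeriv φ) := fun s x hx => by
  rcases le_total |s| T with hs | hs
  · rw [clamp_of_abs_le hs]
  · rw [h.timeDeriv_eq_zero hs hx, h.timeDeriv_eq_zero (le_abs_clamp h.restriction.domain.pos hs)
      ((h.restriction.domain.mem_iff s x).1 hx)]

theorem sliceDeriv_isEndConstant (h : IsTamePair ι T O φ φ₂) :
    IsEndConstant T O (sliceDeriv φ) :=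
  _root_.sliceDeriv_isEndConstant h.restriction.domain
    (h.contDiffOn.differentiableOn two_ne_zero) h.endConstant

end IsTamePair

variable [CompleteSpace H₁]

/-- The fibrewise derivative `(ξ, η) ↦ [s ↦ dφ_s|_{ξ_s} η_s]`. -/
noncomputable def weakTangent (ι : H₂ →L[ℝ] H₁) (φ : ℝ × H₁ → H₁) (ξ : pathSpace ι) :
    L2R H₁ →L[ℝ] L2R H₁ :=
  mulL2 H₁ H₁ (nemytskii (sliceDeriv φ) (pathRep ι ξ))

/-- The weak derivative `s ↦ ∂_sφ(s, ξ_s) + dφ_s|_{ξ_s} ξ'_s` of `s ↦ φ(s, ξ_s)`. -/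
noncomputable def pathDeriv (ι : H₂ →L[ℝ] H₁) (T : ℝ) (φ : ℝ × H₁ → H₁) (ξ : pathSpace ι) :
    L2R H₁ :=
  mulL2 ℝ H₁ (nemytskii (timeDeriv φ) (pathRep ι ξ))
      -- The constant 1 is not in L²; the indicator of [-T, T] may replace it because ∂_sφ vanishes
      -- for |s| ≥ T.
      (indicatorConstLp 2 (measurableSet_Icc (a := -T) (b := T)) (by simp) 1)
    + weakTangent ι φ ξ ξ.1.snd

namespace IsTamePair

theorem contDiffOn_sliceOperator (h : IsTamePair ι T O φ φ₂) :
    ContDiffOn ℝ 1 (fun ξ => nemytskii (sliceDeriv φ) (pathRep ι ξ)) (pathDomain ι O) :=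
  (contDiffOn_nemytskii h.restriction.domain
    (h.contDiffOn.sliceDeriv h.restriction.domain.isOpen) h.sliceDeriv_isEndConstant).comp
    (pathRep ι).contDiff.contDiffOn (pathDomain_eq_preimage O).subset

theorem contDiffOn_timeOperator (h : IsTamePair ι T O φ φ₂) :
    ContDiffOn ℝ 1 (fun ξ => nemytskii (timeDeriv φ) (pathRep ι ξ)) (pathDomain ι O) :=
  (contDiffOn_nemytskii h.restriction.domain
    (h.contDiffOn.timeDeriv h.restriction.domain.isOpen) h.timeDeriv_isEndConstant).comp
    (pathRep ι).contDiff.contDiffOn (pathDomain_eq_preimage O).subset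

theorem contDiffOn_weakTangent (h : IsTamePair ι T O φ φ₂) :
    ContDiffOn ℝ 1 (weakTangent ι φ) (pathDomain ι O) :=
  (contDiff_mulL2 H₁ H₁).comp_contDiffOn h.contDiffOn_sliceOperator

theorem contDiffOn_pathDeriv (h : IsTamePair ι T O φ φ₂) :
    ContDiffOn ℝ 1 (pathDeriv ι T φ) (pathDomain ι O) := by
  have hsnd : ContDiff ℝ 1 fun ξ : pathSpace ι => ξ.1.snd :=
    contDiff_snd.comp ((WithLp.prodContinuousLinearEquiv 2 ℝ (L2R H₂) (L2R H₁)).contDiff.comp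
      (pathSpace ι).subtypeL.contDiff)
  have htime : ContDiffOn ℝ 1 (fun ξ => mulL2 ℝ H₁ (nemytskii (timeDeriv φ) (pathRep ι ξ)))
      (pathDomain ι O) := (contDiff_mulL2 ℝ H₁).comp_contDiffOn h.contDiffOn_timeOperator
  exact (htime.clm_apply contDiffOn_const).add (h.contDiffOn_weakTangent.clm_apply hsnd.contDiffOn)

theorem coeFn_weakTangent (h : IsTamePair ι T O φ φ₂) {ξ : pathSpace ι}
    (hξ : ξ ∈ pathDomain ι O) (η : L2R H₁) :
    weakTangent ι φ ξ η =ᵐ[volume] fun s => sliceDeriv φ (s, pathRep ι ξ s) (η s) := by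
  rw [pathDomain_eq_preimage] at hξ
  filter_upwards [coeFn_mulL2 (nemytskii (sliceDeriv φ) (pathRep ι ξ)) η] with s hs
  rw [weakTangent, hs, nemytskii_apply h.restriction.domain
    (h.contDiffOn.sliceDeriv h.restriction.domain.isOpen).continuousOn
    h.sliceDeriv_isEndConstant hξ]

theorem coeFn_pathDeriv (h : IsTamePair ι T O φ φ₂) {ξ : pathSpace ι}
    (hξ : ξ ∈ pathDomain ι O) :
    pathDeriv ι T φ ξ =ᵐ[volume]
      fun s => fderiv ℝ φ (s, pathRep ι ξ s) (1, ξ.1.snd s) := by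
  have hξ' := hξ
  rw [pathDomain_eq_preimage] at hξ'
  have hT : volume (Icc (-T) T) ≠ ⊤ := by simp
  set χ : L2R ℝ := indicatorConstLp 2 (measurableSet_Icc (a := -T) (b := T)) hT 1 with hχ
  filter_upwards [coeFn_mulL2 (nemytskii (timeDeriv φ) (pathRep ι ξ)) χ,
    h.coeFn_weakTangent hξ ξ.1.snd, Lp.coeFn_add
      (mulL2 ℝ H₁ (nemytskii (timeDeriv φ) (pathRep ι ξ)) χ) (weakTangent ι φ ξ ξ.1.snd),
    indicatorConstLp_coeFn (p := 2) (hs := measurableSet_Icc (a := -T) (b := T)) (hμs := hT)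
      (c := (1 : ℝ))] with s h1 h2 h3 h4
  rw [pathDeriv, h3, Pi.add_apply, h1, h2, fderiv_apply_eq, hχ, h4,
    nemytskii_apply h.restriction.domain
    (h.contDiffOn.timeDeriv h.restriction.domain.isOpen).continuousOn
    h.timeDeriv_isEndConstant hξ']
  by_cases hs : s ∈ Icc (-T) T
  · rw [indicator_of_mem hs]
  · rw [mem_Icc, ← abs_le, not_le] at hs
    rw [h.timeDeriv_eq_zero hs.le (hξ' s)]
    simp

theorem comp_pathRep_sub_eq_integral (h : IsTamePair ι T O φ φ₂) {ξ : pathSpace ι}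
    (hξ : ξ ∈ pathDomain ι O) (a b : ℝ) :
    φ (b, pathRep ι ξ b) - φ (a, pathRep ι ξ a) = ∫ t in a..b, pathDeriv ι T φ ξ t := by
  have hξ' := hξ
  rw [pathDomain_eq_preimage] at hξ'
  have key : ∀ {a b}, a ≤ b →
      φ (b, pathRep ι ξ b) - φ (a, pathRep ι ξ a) = ∫ t in a..b, pathDeriv ι T φ ξ t := by
    intro a b hab
    rw [sub_eq_integral_of_hasFDerivAt (φ' := fderiv ℝ φ) (Lp_two_locallyIntegrable ξ.1.snd)
      (pathRep_sub_eq_integral ι ξ) (fun t => (h.differentiableAt (hξ' t)).hasFDerivAt)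
      ((h.contDiffOn.continuousOn_fderiv_of_isOpen h.restriction.domain.isOpen
        one_le_two).comp_continuous (continuous_id.prodMk (pathRep ι ξ).continuous) hξ') hab]
    refine intervalIntegral.integral_congr_ae ?_
    filter_upwards [h.coeFn_pathDeriv hξ] with t ht _
    exact ht.symm
  rcases le_total a b with hab | hab
  · exact key hab
  · rw [intervalIntegral.integral_symm, ← key hab, neg_sub]

theorem map_superposition_ae_eq [SecondCountableTopology H₂] (h : IsTamePair ι T O φ φ₂)
    {ξ : pathSpace ι} (hξ : ξ ∈ pathDomain ι O) :
    (fun s => φ (s, pathRep ι ξ s)) =ᵐ[volume] fun s => ι (superposition T φ₂ ξ s) := by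
  have hO := h.restriction.domain
  filter_upwards [coeFn_superposition h.restriction hξ, pathRep_ae_eq ι ξ,
    ae_mem_restrictDomain hO hξ] with s h1 h2 h3
  rw [h1, h.map_restriction _ _ h3, h2, h.endConstant _ _ ((hO.mem_iff _ _).2 h3)]

/-- The continuous curve s ↦ φ(s, ξ_s) represents the first component and is a primitive of the
second. -/
theorem mem_pathSpace [SecondCountableTopology H₂] (h : IsTamePair ι T O φ φ₂)
    {ξ : pathSpace ι} (hξ : ξ ∈ pathDomain ι O) :
    WithLp.toLp 2 (superposition T φ₂ ξ, pathDeriv ι T φ ξ) ∈ pathSpace ι :=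
  hasWeakDeriv_of_sub_eq_integral (u := fun s => φ (s, pathRep ι ξ s))
    ((h.map_superposition_ae_eq hξ).trans (ι.coeFn_compLpL _).symm)
    (h.comp_pathRep_sub_eq_integral hξ)

end IsTamePair

end Main

theorem mainTheorem3 {H₁ H₂ : Type*}
    [NormedAddCommGroup H₁] [InnerProductSpace ℝ H₁] [CompleteSpace H₁]
    [TopologicalSpace.SeparableSpace H₁]
    [NormedAddCommGroup H₂] [InnerProductSpace ℝ H₂] [CompleteSpace H₂]
    [TopologicalSpace.SeparableSpace H₂]
    (ι : H₂ →L[ℝ] H₁) (hι_inj : Function.Injective ι) (hι_dense : DenseRange ι)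
    (hι_norm : ∀ y, ‖ι y‖ ≤ ‖y‖)
    (O₁ : Set (ℝ × H₁)) (φ : ℝ × H₁ → H₁)
    (hφ : IsParametrizedTame ι O₁ φ) (hφ_asymp : IsAsymptoticallyConstant O₁ φ) :
    IsOpen (pathDomain ι O₁) ∧
    ∃ (Φ : pathSpace ι → pathSpace ι) (dΦ : pathSpace ι → L2R H₁ → L2R H₁),
      (∀ (ξ : pathSpace ι) (u : ℝ → H₁), IsContRep ι ξ u → (∀ s, (s, u s) ∈ O₁) →
        IsContRep ι (Φ ξ) (fun s => φ (s, u s)) ∧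
        ∀ η : L2R H₁, dΦ ξ η =ᵐ[volume]
          fun s => fderiv ℝ (fun x => φ (s, x)) (u s) (η s)) ∧
      ContDiffOn ℝ 1 Φ (pathDomain ι O₁) ∧
      ContDiffOn ℝ 1 (fun p : pathSpace ι × L2R H₁ => (Φ p.1, dΦ p.1 p.2))
        (pathDomain ι O₁ ×ˢ univ) := by
  have : SecondCountableTopology H₂ := UniformSpace.secondCountable_of_separable H₂
  obtain ⟨hO, hφC, φ₂, hφ₂, hφ₂C, htame⟩ := hφ
  obtain ⟨T, hdom, hend, hzero, hev⟩ := hφ_asymp.exists_isEndConstant hO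
  have h : IsTamePair ι T O₁ φ φ₂ := ⟨hφC, hend, hev, ⟨hι_dense, hι_norm, hdom, hφ₂C, htame,
    -- The vanishing of φ_s at 0 on the ends passes to φ₂ because the inclusion is injective.
    fun s hs => hι_inj (by
      have h0 : (s, ι 0) ∈ O₁ := by rw [map_zero]; exact hdom.zero_mem s hs
      rw [hφ₂ s 0 h0, map_zero, hzero s hs])⟩, hφ₂⟩
  have : CompleteSpace (pathSpace ι) := (isClosed_pathSpace ι).completeSpace_coe
  -- On 𝒰 the pair already lies in the path space and the projection changes nothing. Being
  -- continuous and linear, it transfers C¹ regularity from the ambient product to the subspace and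
  -- makes Φ total.
  set Φ : pathSpace ι → pathSpace ι := fun ξ => (pathSpace ι).orthogonalProjectionOnto
    (WithLp.toLp 2 (superposition T φ₂ ξ, pathDeriv ι T φ ξ)) with hΦ
  have hΦC : ContDiffOn ℝ 1 Φ (pathDomain ι O₁) :=
    ((pathSpace ι).orthogonalProjectionOnto.contDiff.comp
      (WithLp.prodContinuousLinearEquiv 2 ℝ (L2R H₂) (L2R H₁)).symm.contDiff).comp_contDiffOn
      ((contDiffOn_superposition h.restriction).prodMk h.contDiffOn_pathDeriv)
  refine ⟨isOpen_pathDomain hdom, Φ, fun ξ η => weakTangent ι φ ξ η, fun ξ u hu huO => ?_,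
    hΦC, ?_⟩
  · have hξ : ξ ∈ pathDomain ι O₁ := ⟨u, hu, huO⟩
    obtain rfl := hu.eq_pathRep
    refine ⟨⟨hφC.continuousOn.comp_continuous
      (continuous_id.prodMk (pathRep ι ξ).continuous) huO, ?_⟩, fun η => ?_⟩
    · have hval : Φ ξ = ⟨_, h.mem_pathSpace hξ⟩ :=
        Submodule.orthogonalProjectionOnto_mem_subspace_eq_self (K := pathSpace ι)
          ⟨_, h.mem_pathSpace hξ⟩
      rw [hval]
      exact h.map_superposition_ae_eq hξ
    · filter_upwards [h.coeFn_weakTangent hξ η] with s hs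
      rw [hs, (hasFDerivAt_slice (h.differentiableAt (huO s))).fderiv]
  · have hfst : MapsTo Prod.fst (pathDomain ι O₁ ×ˢ (univ : Set (L2R H₁))) (pathDomain ι O₁) :=
      fun p hp => hp.1
    -- The operator dφ(ξ) depends C¹ on ξ in operator norm, so its evaluation is C¹ jointly in (ξ,
    -- η).
    exact (hΦC.comp contDiffOn_fst hfst).prodMk
      ((h.contDiffOn_weakTangent.comp contDiffOn_fst hfst).clm_apply contDiffOn_snd)
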